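/- **Language.** Two-sorted first-order logic with equality, with a sort $B$ of bodies and a sort $Q$ of quantities (both nonempty), unary relations $IOb$ and $Ph$ on $B$ ("inertial observer", "light signal"), binary functions $+,\cdot$ and a binary relation $\le$ on $Q$, and a relation $W$ of sort $B^2\times Q^4$ ("$k$ coordinatizes $b$ at $\bar x=(x_0,x_1,x_2,x_3)$"). A theory is a set of sentences, and $\mathsf{Th}\vdash\varphi$ is provability in classical first-order logic. **Definitional equivalence.** A translation $Tr$ assigns to each basic relation (the functions $+,\cdot$ being regarded as the ternary relations $x+y=z$, $x\cdot y=z$) a formula with one free variable of the corresponding sort for each place, and extends to all formulas by preserving equality in both sorts, logical connectives and quantifiers. $Tr$ is an interpretation of $\mathsf{Th}_1$ in $\mathsf{Th}_2$ if $\mathsf{Th}_1\vdash\varphi$ implies $\mathsf{Th}_2\vdash Tr(\varphi)$ for every formula $\varphi$. $\mathsf{Th}_1$ and $\mathsf{Th}_2$ are definitionally equivalent if there are an interpretation $Tr$ of $\mathsf{Th}_1$ in $\mathsf{Th}_2$ and an interpretation $Tr'$ of $\mathsf{Th}_2$ in $\mathsf{Th}_1$ such that $\mathsf{Th}_1\vdash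 Tr'(Tr(\varphi))\leftrightarrow\varphi$ and $\mathsf{Th}_2\vdash Tr(Tr'(\psi))\leftrightarrow\psi$ for all formulas $\varphi,\psi$. **Abbreviations.** $space(\bar x,\bar y)=\sqrt{(x_1-y_1)^2+(x_2-y_2)^2+(x_3-y_3)^2}$; $time(\bar x,\bar y)=|x_0-y_0|$; $\bar x\in wl_k(b)$ and $b\in ev_k(\bar x)$ both mean $W(k,b,\bar x)$; $w_{kk'}(\bar x,\bar y)$ means $ev_k(\bar x)=ev_{k'}(\bar y)$, i.e. $\forall b\,(W(k,b,\bar x)\leftrightarrow W(k',b,\bar y))$. **$\mathsf{Kin}_{Full}$** consists of the following axioms: - AxEField: $\langle Q,+,\cdot,\le\rangle$ is a Euclidean field, i.e. a linearly ordered field in which every positive element has a square root. - AxEv: for all $k,h\in IOb$ and $\bar x\in Q^4$ there is $\bar y\in Q^4$ with $ev_k(\bar x)=ev_h(\bar y)$. - AxSelf: for all $k\in IOb$ and $t,x,y,z\in Q$: $W(k,k,t,x,y,z)\leftrightarrow x=y=z=0$. - AxSymD: for all $k,k'\in IOb$ and $\bar x,\bar y,\bar x',\bar y'\in Q^4$,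 if $time(\bar x,\bar y)=time(\bar x',\bar y')=0$, $ev_k(\bar x)=ev_{k'}(\bar x')$ and $ev_k(\bar y)=ev_{k'}(\bar y')$, then $space(\bar x,\bar y)=space(\bar x',\bar y')$. - AxLine: for all $k,h\in IOb$ and $\bar x,\bar y,\bar z\in wl_k(h)$ there is $a\in Q$ with $\bar z-\bar x=a(\bar y-\bar x)$ or $\bar y-\bar z=a(\bar z-\bar x)$. - AxTriv: for every affine map $T:Q^4\to Q^4$ that is an isometry on space and a translation along the time axis (i.e. there is $\tau\in Q$ with $T(\bar x)_0=x_0+\tau$ and $space(T(\bar x),T(\bar y))=space(\bar x,\bar y)$ for all $\bar x,\bar y\in Q^4$), and for every $k\in IOb$, there is $k'\in IOb$ with $w_{kk'}=T$; this is one first-order sentence, quantifying over the $16+4$ coefficients of $T$. - AxNoAcc: if $\exists b\,\exists\bar x\, W(k,b,\bar x)$, then $IOb(k)$. **$\mathsf{ClassicalKin}_{Full}$** is $\mathsf{Kin}_{Full}$ together with: - AxAbsTime: for all $k,k'\in IOb$ and $\bar x,\bar y,\bar x',\bar y'\in Q^4$, if $ev_k(\bar x)=ev_{k'}(\bar x')$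 and $ev_k(\bar y)=ev_{k'}(\bar y')$, then $time(\bar x,\bar y)=time(\bar x',\bar y')$. - AxThExp$_+$: there is an inertial observer, and for all $k\in IOb$ and $\bar x,\bar y\in Q^4$ with $x_0\ne y_0$ there is $k'\in IOb$ with $\bar x,\bar y\in wl_k(k')$. - AxEther: there are $e\in IOb$ and $c>0$ such that for all $\bar x,\bar y\in Q^4$: $\exists p\in Ph\,[\bar x,\bar y\in wl_e(p)]\leftrightarrow space(\bar x,\bar y)=c\cdot time(\bar x,\bar y)$. **$\mathsf{SpecRel}_{Full}$** is $\mathsf{Kin}_{Full}$ together with: - AxPh$_c$: there is $c>0$ such that for all $k\in IOb$ and $\bar x,\bar y\in Q^4$: $\exists p\in Ph\,[\bar x,\bar y\in wl_k(p)]\leftrightarrow space(\bar x,\bar y)=c\cdot time(\bar x,\bar y)$. - AxThExp: there is an inertial observer, and for all $k\in IOb$ and $\bar x,\bar y\in Q^4$ with $space(\bar x,\bar y)<\mathfrak c\cdot time(\bar x,\bar y)$, where $\mathfrak c$ is the speed of light given by AxPh$_c$, there is $k'\in IOb$ with $\bar x,\bar y\in wl_k(k')$. **Corollary.** $\mathsf{SpecRel}_{Full}$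 and $\mathsf{ClassicalKin}_{Full}$ are not definitionally equivalent. -/

import Mathlib

/-! # Two-sorted first-order logic over the language `{B, Q; IOb, Ph, +, ·, ≤, W}`

Formulas are well scoped: an element of `Fml m n` is a formula whose free variables are among
`m` body variables (`Fin m`) and `n` quantity variables (`Fin n`).  A quantifier binds the variable
with the largest number, so that the number of a variable does not change below a quantifier: the
first quantified variable of a sentence (of the given sort) is `0`, the next one `1`, and so on. -/

namespace Kinematics

/-- Quantity terms in `n` quantity variables.  (Body terms are just body variables.) -/
inductive QTerm (n : ℕ) : Type
  | var (i : Fin n) : QTerm n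
  | add (s t : QTerm n) : QTerm n
  | mul (s t : QTerm n) : QTerm n

namespace QTerm

instance {n : ℕ} : Add (QTerm n) := ⟨QTerm.add⟩

instance {n : ℕ} : Mul (QTerm n) := ⟨QTerm.mul⟩

/-- Simultaneous substitution of terms for the variables. -/
def subst {n n' : ℕ} (σ : Fin n → QTerm n') : QTerm n → QTerm n'
  | var i => σ i
  | add s t => add (s.subst σ) (t.subst σ)
  | mul s t => mul (s.subst σ) (t.subst σ)

/-- Read a term in `n` variables as a term in `n + j` variables. -/
def lift {n : ℕ} (j : ℕ) (t : QTerm n) : QTerm (n + j) := t.subst fun i => var (Fin.castAdd j i)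

end QTerm

/-- Formulas with `m` free body variables and `n` free quantity variables.  The other connectives
and the existential quantifiers are the usual classical abbreviations. -/
inductive Fml : ℕ → ℕ → Type
  | falsum {m n : ℕ} : Fml m n
  | eqB {m n : ℕ} (k b : Fin m) : Fml m n
  | eqQ {m n : ℕ} (s t : QTerm n) : Fml m n
  | le {m n : ℕ} (s t : QTerm n) : Fml m n
  | IOb {m n : ℕ} (k : Fin m) : Fml m n
  | Ph {m n : ℕ} (p : Fin m) : Fml m n
  | W {m n : ℕ} (k b : Fin m) (x : Fin 4 → QTerm n) : Fml m n
  | imp {m n : ℕ} (φ ψ : Fml m n) : Fml m n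
  | allB {m n : ℕ} (φ : Fml (m + 1) n) : Fml m n
  | allQ {m n : ℕ} (φ : Fml m (n + 1)) : Fml m n

namespace Fml

def neg {m n : ℕ} (φ : Fml m n) : Fml m n := imp φ falsum

def and {m n : ℕ} (φ ψ : Fml m n) : Fml m n := neg (imp φ (neg ψ))

def or {m n : ℕ} (φ ψ : Fml m n) : Fml m n := imp (neg φ) ψ

def iff {m n : ℕ} (φ ψ : Fml m n) : Fml m n := and (imp φ ψ) (imp ψ φ)

def exB {m n : ℕ} (φ : Fml (m + 1) n) : Fml m n := neg (allB (neg φ))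

def exQ {m n : ℕ} (φ : Fml m (n + 1)) : Fml m n := neg (allQ (neg φ))

/-- Extend a renaming of body variables by sending the new variable to the new variable. -/
def upB {m m' : ℕ} (σ : Fin m → Fin m') : Fin (m + 1) → Fin (m' + 1) :=
  Fin.snoc (α := fun _ => Fin (m' + 1)) (fun i => (σ i).castSucc) (Fin.last m')

/-- Extend a substitution for quantity variables by sending the new variable to the new
variable. -/
def upQ {n n' : ℕ} (σ : Fin n → QTerm n') : Fin (n + 1) → QTerm (n' + 1) :=
  Fin.snoc (α := fun _ => QTerm (n' + 1)) (fun i => (σ i).lift 1) (QTerm.var (Fin.last n'))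

/-- Simultaneous (capture-free) substitution of body variables for body variables and of quantity
terms for quantity variables. -/
def subst : {m n m' n' : ℕ} → (Fin m → Fin m') → (Fin n → QTerm n') → Fml m n → Fml m' n'
  | _, _, _, _, _, _, falsum => falsum
  | _, _, _, _, σ, _, eqB k b => eqB (σ k) (σ b)
  | _, _, _, _, _, τ, eqQ s t => eqQ (s.subst τ) (t.subst τ)
  | _, _, _, _, _, τ, le s t => le (s.subst τ) (t.subst τ)
  | _, _, _, _, σ, _, IOb k => IOb (σ k)
  | _, _, _, _, σ, _, Ph p => Ph (σ p)
  | _, _, _, _, σ, τ, W k b x => W (σ k) (σ b) fun i => (x i).subst τ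
  | _, _, _, _, σ, τ, imp φ ψ => imp (subst σ τ φ) (subst σ τ ψ)
  | _, _, _, _, σ, τ, allB φ => allB (subst (upB σ) τ φ)
  | _, _, _, _, σ, τ, allQ φ => allQ (subst σ (upQ τ) φ)

/-- Add a new free body variable that does not occur. -/
def weakenB {m n : ℕ} (φ : Fml m n) : Fml (m + 1) n := φ.subst Fin.castSucc QTerm.var

/-- Add a new free quantity variable that does not occur. -/
def weakenQ {m n : ℕ} (φ : Fml m n) : Fml m (n + 1) :=
  φ.subst id fun i => QTerm.var i.castSucc

/-- Replace the last body variable by the body variable `b`. -/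
def instB {m n : ℕ} (φ : Fml (m + 1) n) (b : Fin m) : Fml m n :=
  φ.subst (Fin.snoc (α := fun _ => Fin m) id b) QTerm.var

/-- Replace the last quantity variable by the quantity term `t`. -/
def instQ {m n : ℕ} (φ : Fml m (n + 1)) (t : QTerm n) : Fml m n :=
  φ.subst id (Fin.snoc (α := fun _ => QTerm n) QTerm.var t)

end Fml

/-- Classical natural deduction for two-sorted first-order logic with equality, both sorts being
nonempty: `Derivable Γ φ` means that `φ` has a derivation from the hypotheses `Γ`. -/
inductive Derivable : {m n : ℕ} → Set (Fml m n) → Fml m n → Prop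
  | hyp {m n : ℕ} {Γ : Set (Fml m n)} {φ : Fml m n} (h : φ ∈ Γ) : Derivable Γ φ
  | impI {m n : ℕ} {Γ : Set (Fml m n)} {φ ψ : Fml m n}
      (h : Derivable (insert φ Γ) ψ) : Derivable Γ (φ.imp ψ)
  | impE {m n : ℕ} {Γ : Set (Fml m n)} {φ ψ : Fml m n}
      (h₁ : Derivable Γ (φ.imp ψ)) (h₂ : Derivable Γ φ) : Derivable Γ ψ
  | contra {m n : ℕ} {Γ : Set (Fml m n)} {φ : Fml m n}
      (h : Derivable (insert φ.neg Γ) Fml.falsum) : Derivable Γ φ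
  | allBI {m n : ℕ} {Γ : Set (Fml m n)} {φ : Fml (m + 1) n}
      (h : Derivable (Fml.weakenB '' Γ) φ) : Derivable Γ φ.allB
  | allBE {m n : ℕ} {Γ : Set (Fml m n)} {φ : Fml (m + 1) n}
      (h : Derivable Γ φ.allB) (b : Fin m) : Derivable Γ (φ.instB b)
  | allQI {m n : ℕ} {Γ : Set (Fml m n)} {φ : Fml m (n + 1)}
      (h : Derivable (Fml.weakenQ '' Γ) φ) : Derivable Γ φ.allQ
  | allQE {m n : ℕ} {Γ : Set (Fml m n)} {φ : Fml m (n + 1)}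
      (h : Derivable Γ φ.allQ) (t : QTerm n) : Derivable Γ (φ.instQ t)
  | reflB {m n : ℕ} {Γ : Set (Fml m n)} (b : Fin m) : Derivable Γ (Fml.eqB b b)
  | replB {m n : ℕ} {Γ : Set (Fml m n)} (φ : Fml (m + 1) n) {b b' : Fin m}
      (h₁ : Derivable Γ (Fml.eqB b b')) (h₂ : Derivable Γ (φ.instB b)) :
      Derivable Γ (φ.instB b')
  | reflQ {m n : ℕ} {Γ : Set (Fml m n)} (t : QTerm n) : Derivable Γ (Fml.eqQ t t)
  | replQ {m n : ℕ} {Γ : Set (Fml m n)} (φ : Fml m (n + 1)) {t t' : QTerm n}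
      (h₁ : Derivable Γ (Fml.eqQ t t')) (h₂ : Derivable Γ (φ.instQ t)) :
      Derivable Γ (φ.instQ t')
  | nonemptyB {m n : ℕ} {Γ : Set (Fml m n)} :
      Derivable Γ (Fml.exB (Fml.eqB (Fin.last m) (Fin.last m)))
  | nonemptyQ {m n : ℕ} {Γ : Set (Fml m n)} :
      Derivable Γ (Fml.exQ (Fml.eqQ (QTerm.var (Fin.last n)) (QTerm.var (Fin.last n))))

/-- A theory is a set of sentences. -/
abbrev Theory : Type := Set (Fml 0 0)

/-- `Th ⊢ φ`, for a formula `φ` that may have free variables. -/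
def Theory.Proves (Th : Theory) {m n : ℕ} (φ : Fml m n) : Prop :=
  Derivable ((fun σ : Fml 0 0 => σ.subst (Fin.elim0 : Fin 0 → Fin m)
    (Fin.elim0 : Fin 0 → QTerm n)) '' Th) φ

/-! ### Translations, interpretations, definitional equivalence -/

/-- A translation is given by the formulas into which it translates the basic relations, one
variable for each place of the relation.  The functions `+` and `·` are treated as the ternary
relations `x + y = z` and `x · y = z`, their formulas having the variables `x, y, z` in this
order. -/
structure Translation where
  IOb : Fml 1 0
  Ph : Fml 1 0
  W : Fml 2 4
  le : Fml 0 2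
  add : Fml 0 3
  mul : Fml 0 3

namespace Translation

/-- The instance of `φ` for the given variables. -/
def sub {a c m n : ℕ} (φ : Fml a c) (k : Fin a → Fin m) (x : Fin c → Fin n) : Fml m n :=
  φ.subst k fun i => QTerm.var (x i)

/-- The translation of `t = z`, where `z` is a variable and the variables of `t` are renamed by
`ρ`; functions are reduced to relations, i.e. `s + t = z` is read as
`∃ u v, s = u ∧ t = v ∧ u + v = z`. -/
def graph (Tr : Translation) {m n : ℕ} : QTerm n → {n' : ℕ} → (Fin n → Fin n') → Fin n' → Fml m n'
  | .var i, _, ρ, z => Fml.eqQ (.var (ρ i)) (.var z)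
  | .add s t, n', ρ, z =>
      .exQ (.exQ (((Tr.graph s (fun i => Fin.castAdd 2 (ρ i)) (Fin.natAdd n' 0)).and
        (Tr.graph t (fun i => Fin.castAdd 2 (ρ i)) (Fin.natAdd n' 1))).and
          (sub Tr.add Fin.elim0 ![Fin.natAdd n' 0, Fin.natAdd n' 1, Fin.castAdd 2 z])))
  | .mul s t, n', ρ, z =>
      .exQ (.exQ (((Tr.graph s (fun i => Fin.castAdd 2 (ρ i)) (Fin.natAdd n' 0)).and
        (Tr.graph t (fun i => Fin.castAdd 2 (ρ i)) (Fin.natAdd n' 1))).and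
          (sub Tr.mul Fin.elim0 ![Fin.natAdd n' 0, Fin.natAdd n' 1, Fin.castAdd 2 z])))

/-- The translation of an atomic formula `R(s, t)` about quantities, where the relation `R` on
variables is translated to `φ`: `∃ u v, s = u ∧ t = v ∧ φ(u, v)`. -/
def atom₂ (Tr : Translation) {m n : ℕ} (φ : Fml 0 2) (s t : QTerm n) : Fml m n :=
  .exQ (.exQ (((Tr.graph s (Fin.castAdd 2) (Fin.natAdd n 0)).and
    (Tr.graph t (Fin.castAdd 2) (Fin.natAdd n 1))).and
      (sub φ Fin.elim0 ![Fin.natAdd n 0, Fin.natAdd n 1])))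

/-- The translation of `W(k, b, x₀, x₁, x₂, x₃)` for terms `xᵢ`:
`∃ u₀ u₁ u₂ u₃, x₀ = u₀ ∧ x₁ = u₁ ∧ x₂ = u₂ ∧ x₃ = u₃ ∧ φ(k, b, u₀, u₁, u₂, u₃)`,
where `φ` is the translation of `W` on variables. -/
def atomW (Tr : Translation) {m n : ℕ} (k b : Fin m) (x : Fin 4 → QTerm n) : Fml m n :=
  .exQ (.exQ (.exQ (.exQ
    ((Tr.graph (x 0) (Fin.castAdd 4) (Fin.natAdd n 0)).and
      ((Tr.graph (x 1) (Fin.castAdd 4) (Fin.natAdd n 1)).and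
        ((Tr.graph (x 2) (Fin.castAdd 4) (Fin.natAdd n 2)).and
          ((Tr.graph (x 3) (Fin.castAdd 4) (Fin.natAdd n 3)).and
            (sub Tr.W ![k, b] (Fin.natAdd n)))))))))

/-- The translation of a formula: equality, connectives and quantifiers are preserved, basic
relations are replaced by the formulas given by the translation. -/
def tr (Tr : Translation) : {m n : ℕ} → Fml m n → Fml m n
  | _, _, .falsum => .falsum
  | _, _, .eqB k b => .eqB k b
  | _, _, .eqQ s t => Tr.atom₂ (.eqQ (.var 0) (.var 1)) s t
  | _, _, .le s t => Tr.atom₂ Tr.le s t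
  | _, _, .IOb k => sub Tr.IOb ![k] Fin.elim0
  | _, _, .Ph p => sub Tr.Ph ![p] Fin.elim0
  | _, _, .W k b x => Tr.atomW k b x
  | _, _, .imp φ ψ => .imp (Tr.tr φ) (Tr.tr ψ)
  | _, _, .allB φ => .allB (Tr.tr φ)
  | _, _, .allQ φ => .allQ (Tr.tr φ)

/-- `Tr` is an interpretation of `Th₁` in `Th₂`. -/
def IsInterpretation (Tr : Translation) (Th₁ Th₂ : Theory) : Prop :=
  ∀ (m n : ℕ) (φ : Fml m n), Th₁.Proves φ → Th₂.Proves (Tr.tr φ)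

/-- The interpretation `Tr` of `Th₁` in `Th₂` is a definitional equivalence. -/
def IsDefinitionalEquivalence (Tr : Translation) (Th₁ Th₂ : Theory) : Prop :=
  Tr.IsInterpretation Th₁ Th₂ ∧
    ∃ Tr' : Translation, Tr'.IsInterpretation Th₂ Th₁ ∧
      (∀ (m n : ℕ) (φ : Fml m n), Th₁.Proves ((Tr'.tr (Tr.tr φ)).iff φ)) ∧
      (∀ (m n : ℕ) (ψ : Fml m n), Th₂.Proves ((Tr.tr (Tr'.tr ψ)).iff ψ))

end Translation

/-- `Th₁ ≡_Δ Th₂`. -/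
def Theory.DefinitionallyEquivalent (Th₁ Th₂ : Theory) : Prop :=
  ∃ Tr : Translation, Tr.IsDefinitionalEquivalence Th₁ Th₂

/-! ### Abbreviations used in the axioms -/

local infix:50 " ≐ " => Fml.eqQ
local infix:50 " ≦ " => Fml.le
local infixr:35 " ⋏ " => Fml.and
local infixr:30 " ⋎ " => Fml.or
local infixr:25 " ⇾ " => Fml.imp
local infix:20 " ⇿ " => Fml.iff

/-- `∀ x ∈ Q⁴`. -/
def allQ4 {m n : ℕ} (φ : Fml m (n + 4)) : Fml m n := .allQ (.allQ (.allQ (.allQ φ)))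

/-- `∃ x ∈ Q⁴`. -/
def exQ4 {m n : ℕ} (φ : Fml m (n + 4)) : Fml m n := .exQ (.exQ (.exQ (.exQ φ)))

/-- `∀ k ∈ IOb`. -/
def allIOb {m n : ℕ} (φ : Fml (m + 1) n) : Fml m n := .allB (.IOb (Fin.last m) ⇾ φ)

/-- `∃ k ∈ IOb`. -/
def exIOb {m n : ℕ} (φ : Fml (m + 1) n) : Fml m n := .exB (.IOb (Fin.last m) ⋏ φ)

/-- `∃ p ∈ Ph`. -/
def exPh {m n : ℕ} (φ : Fml (m + 1) n) : Fml m n := .exB (.Ph (Fin.last m) ⋏ φ)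

/-- The quantity variable with number `i`. -/
def v {n : ℕ} (i : ℕ) (h : i < n := by omega) : QTerm n := .var ⟨i, h⟩

/-- The quadruple of quantity variables with numbers `i, i + 1, i + 2, i + 3`. -/
def pt {n : ℕ} (i : ℕ) (h : i + 4 ≤ n := by omega) : Fin 4 → QTerm n :=
  fun j => .var ⟨i + j, by omega⟩

/-- Read a quadruple of terms in `n` variables as one in `n + j` variables. -/
def liftPt {n : ℕ} (j : ℕ) (x : Fin 4 → QTerm n) : Fin 4 → QTerm (n + j) := fun i => (x i).lift j

/-- `t = 0`. -/
def isZero {m n : ℕ} (t : QTerm n) : Fml m n := .allQ (v n + t.lift 1 ≐ v n)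

/-- `t = 1`. -/
def isOne {m n : ℕ} (t : QTerm n) : Fml m n := .allQ (v n * t.lift 1 ≐ v n)

/-- `s < t`. -/
def lt {m n : ℕ} (s t : QTerm n) : Fml m n := (s ≦ t) ⋏ (s ≐ t).neg

/-- `0 ≤ t`. -/
def nonneg {m n : ℕ} (t : QTerm n) : Fml m n := .exQ (isZero (v n) ⋏ v n ≦ t.lift 1)

/-- `0 < t`. -/
def pos {m n : ℕ} (t : QTerm n) : Fml m n := .exQ (isZero (v n) ⋏ lt (v n) (t.lift 1))

/-- `s = space(x, y)`: there are `dᵢ = xᵢ - yᵢ` for `i = 1, 2, 3` such that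
`s = √(d₁² + d₂² + d₃²)`. -/
def isSpace {m n : ℕ} (s : QTerm n) (x y : Fin 4 → QTerm n) : Fml m n :=
  .exQ (.exQ (.exQ (
    (v n + liftPt 3 y 1 ≐ liftPt 3 x 1) ⋏
    (v (n + 1) + liftPt 3 y 2 ≐ liftPt 3 x 2) ⋏
    (v (n + 2) + liftPt 3 y 3 ≐ liftPt 3 x 3) ⋏
    nonneg (s.lift 3) ⋏
    (s.lift 3 * s.lift 3 ≐ v n * v n + v (n + 1) * v (n + 1) + v (n + 2) * v (n + 2)))))

/-- `t = time(x, y)`: there is `d = x₀ - y₀` such that `t = |d|`. -/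
def isTime {m n : ℕ} (t : QTerm n) (x y : Fin 4 → QTerm n) : Fml m n :=
  .exQ ((v n + liftPt 1 y 0 ≐ liftPt 1 x 0) ⋏ nonneg (t.lift 1) ⋏
    ((t.lift 1 ≐ v n) ⋎ isZero (t.lift 1 + v n)))

/-- `space(x, y) = space(x', y')`. -/
def eqSpace {m n : ℕ} (x y x' y' : Fin 4 → QTerm n) : Fml m n :=
  .exQ (isSpace (v n) (liftPt 1 x) (liftPt 1 y) ⋏ isSpace (v n) (liftPt 1 x') (liftPt 1 y'))

/-- `time(x, y) = time(x', y')`. -/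
def eqTime {m n : ℕ} (x y x' y' : Fin 4 → QTerm n) : Fml m n :=
  .exQ (isTime (v n) (liftPt 1 x) (liftPt 1 y) ⋏ isTime (v n) (liftPt 1 x') (liftPt 1 y'))

/-- `time(x, y) = time(x', y') = 0`. -/
def eqTimeZero {m n : ℕ} (x y x' y' : Fin 4 → QTerm n) : Fml m n :=
  .exQ (isTime (v n) (liftPt 1 x) (liftPt 1 y) ⋏ isTime (v n) (liftPt 1 x') (liftPt 1 y') ⋏
    isZero (v n))

/-- `space(x, y) = c · time(x, y)`. -/
def lightlike {m n : ℕ} (c : QTerm n) (x y : Fin 4 → QTerm n) : Fml m n :=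
  .exQ (.exQ (isSpace (v n) (liftPt 2 x) (liftPt 2 y) ⋏
    isTime (v (n + 1)) (liftPt 2 x) (liftPt 2 y) ⋏ (v n ≐ c.lift 2 * v (n + 1))))

/-- `space(x, y) < c · time(x, y)`. -/
def timelike {m n : ℕ} (c : QTerm n) (x y : Fin 4 → QTerm n) : Fml m n :=
  .exQ (.exQ (isSpace (v n) (liftPt 2 x) (liftPt 2 y) ⋏
    isTime (v (n + 1)) (liftPt 2 x) (liftPt 2 y) ⋏ lt (v n) (c.lift 2 * v (n + 1))))

/-- `ev_k(x) = ev_h(y)`, i.e. `w_{kh}(x, y)`. -/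
def sameEv {m n : ℕ} (k h : Fin m) (x y : Fin 4 → QTerm n) : Fml m n :=
  .allB (.W k.castSucc (Fin.last m) x ⇿ .W h.castSucc (Fin.last m) y)

/-- `∀ x, y ∈ Q⁴ (∃ p ∈ Ph [x, y ∈ wl_k(p)] ↔ space(x, y) = c · time(x, y))`. -/
def lightSpeedFor {m n : ℕ} (k : Fin m) (c : QTerm n) : Fml m n :=
  allQ4 (allQ4
    (exPh (.W k.castSucc (Fin.last m) (pt n) ⋏ .W k.castSucc (Fin.last m) (pt (n + 4))) ⇿
      lightlike ((c.lift 4).lift 4) (pt n) (pt (n + 4))))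

/-- `c` is the observer-independent speed of light: `c > 0` and `c` is the speed of light in every
direction everywhere for all inertial observers. -/
def isLightSpeed {m n : ℕ} (c : QTerm n) : Fml m n :=
  pos c ⋏ allIOb (lightSpeedFor (Fin.last m) c)

/-- `Ether(e)`. -/
def ether {m n : ℕ} (e : Fin m) : Fml m n :=
  .IOb e ⋏ .exQ (pos (v n) ⋏ lightSpeedFor e (v n))

/-- `Ob(k)`. -/
def ob {m n : ℕ} (k : Fin m) : Fml m n := .exB (exQ4 (.W k.castSucc (Fin.last m) (pt n)))

/-- `x' = T(x)`, where `T` is the affine map `x ↦ A x + q` of `Q⁴`. -/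
def affine {m n : ℕ} (A : Fin 4 → Fin 4 → QTerm n) (q x x' : Fin 4 → QTerm n) : Fml m n :=
  let row : Fin 4 → Fml m n := fun i =>
    (x' i ≐ A i 0 * x 0 + A i 1 * x 1 + A i 2 * x 2 + A i 3 * x 3 + q i)
  row 0 ⋏ row 1 ⋏ row 2 ⋏ row 3

/-- The affine map `T : x ↦ A x + q` is a trivial transformation, i.e. an isometry on space and
a translation along the time axis: `T(x)₀ = x₀ + q₀` and `space(T(x), T(y)) = space(x, y)` for all
`x, y ∈ Q⁴`. -/
def isTriv {m n : ℕ} (A : Fin 4 → Fin 4 → QTerm n) (q : Fin 4 → QTerm n) : Fml m n :=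
  -- The variables `n, …, n + 15` are the coordinates of `x, y, x', y'`.
  allQ4 (allQ4 (allQ4 (allQ4
    (affine (fun i j => (A i j).lift 16) (liftPt 16 q) (pt n) (pt (n + 8)) ⋏
      affine (fun i j => (A i j).lift 16) (liftPt 16 q) (pt (n + 4)) (pt (n + 12)) ⇾
      (v (n + 8) ≐ v n + liftPt 16 q 0) ⋏
        eqSpace (pt n) (pt (n + 4)) (pt (n + 8)) (pt (n + 12))))))

/-! ### The axioms -/

/-- `⟨Q, +, ·, ≤⟩` is a Euclidean field. -/
def AxEField : Fml 0 0 :=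
  -- `⟨Q, +, ·⟩` is a field
  (.allQ (.allQ (.allQ ((v 0 + v 1) + v 2 ≐ v 0 + (v 1 + v 2))))) ⋏
  (.allQ (.allQ (v 0 + v 1 ≐ v 1 + v 0))) ⋏
  (.exQ (isZero (v 0))) ⋏
  (.allQ (.exQ (isZero (v 0 + v 1)))) ⋏
  (.allQ (.allQ (.allQ ((v 0 * v 1) * v 2 ≐ v 0 * (v 1 * v 2))))) ⋏
  (.allQ (.allQ (v 0 * v 1 ≐ v 1 * v 0))) ⋏
  (.exQ (isOne (v 0) ⋏ (isZero (v 0)).neg)) ⋏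
  (.allQ ((isZero (v 0)).neg ⇾ .exQ (isOne (v 0 * v 1)))) ⋏
  (.allQ (.allQ (.allQ (v 0 * (v 1 + v 2) ≐ v 0 * v 1 + v 0 * v 2)))) ⋏
  -- `≤` is a linear ordering
  (.allQ (v 0 ≦ v 0)) ⋏
  (.allQ (.allQ ((v 0 ≦ v 1) ⋏ (v 1 ≦ v 0) ⇾ v 0 ≐ v 1))) ⋏
  (.allQ (.allQ (.allQ ((v 0 ≦ v 1) ⋏ (v 1 ≦ v 2) ⇾ v 0 ≦ v 2)))) ⋏
  (.allQ (.allQ ((v 0 ≦ v 1) ⋎ (v 1 ≦ v 0)))) ⋏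
  -- compatibility of the ordering with the field operations
  (.allQ (.allQ (.allQ (v 0 ≦ v 1 ⇾ v 0 + v 2 ≦ v 1 + v 2)))) ⋏
  (.allQ (.allQ (nonneg (v 0) ⋏ nonneg (v 1) ⇾ nonneg (v 0 * v 1)))) ⋏
  -- every positive number has a square root
  (.allQ (pos (v 0) ⇾ .exQ (v 1 * v 1 ≐ v 0)))

/-- All inertial observers coordinatize the same events. -/
def AxEv : Fml 0 0 := allIOb (allIOb (allQ4 (exQ4 (sameEv 0 1 (pt 0) (pt 4)))))

/-- Any inertial observer is stationary in his own coordinate system. -/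
def AxSelf : Fml 0 0 :=
  allIOb (allQ4 (.W 0 0 (pt 0) ⇿ isZero (v 1) ⋏ isZero (v 2) ⋏ isZero (v 3)))

/-- Inertial observers agree as to the spatial distance between two events that are simultaneous
for both of them.  The four quadruples are `x, y, x', y'`. -/
def AxSymD : Fml 0 0 :=
  allIOb (allIOb (allQ4 (allQ4 (allQ4 (allQ4
    (eqTimeZero (pt 0) (pt 4) (pt 8) (pt 12) ⋏
      sameEv 0 1 (pt 0) (pt 8) ⋏ sameEv 0 1 (pt 4) (pt 12) ⇾
        eqSpace (pt 0) (pt 4) (pt 8) (pt 12)))))))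

/-- The worldline of an inertial observer is a straight line according to inertial observers.
The three quadruples are `x, y, z`; the variable `12` is `a`.  The equations `z - x = a (y - x)`
and `y - z = a (z - x)` are written as `z + a x = a y + x` and `y + a x = a z + z`. -/
def AxLine : Fml 0 0 :=
  allIOb (allIOb (allQ4 (allQ4 (allQ4
    (.W 0 1 (pt 0) ⋏ .W 0 1 (pt 4) ⋏ .W 0 1 (pt 8) ⇾ .exQ (
      ((v 8 + v 12 * v 0 ≐ v 12 * v 4 + v 0) ⋏ (v 9 + v 12 * v 1 ≐ v 12 * v 5 + v 1) ⋏
        (v 10 + v 12 * v 2 ≐ v 12 * v 6 + v 2) ⋏ (v 11 + v 12 * v 3 ≐ v 12 * v 7 + v 3)) ⋎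
      ((v 4 + v 12 * v 0 ≐ v 12 * v 8 + v 8) ⋏ (v 5 + v 12 * v 1 ≐ v 12 * v 9 + v 9) ⋏
        (v 6 + v 12 * v 2 ≐ v 12 * v 10 + v 10) ⋏
        (v 7 + v 12 * v 3 ≐ v 12 * v 11 + v 11))))))))

/-- Any trivial transformation of an inertial coordinate system is also an inertial coordinate
system: for all trivial `T` and all `k ∈ IOb` there is `k' ∈ IOb` such that
`w_{kk'}(x, x') ↔ T(x) = x'` for all `x, x' ∈ Q⁴`.  The first 16 variables are the entries of the
matrix of `T`, the next four its translation vector, then come `x` and `x'`. -/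
def AxTriv : Fml 0 0 :=
  allQ4 (allQ4 (allQ4 (allQ4 (allQ4
    (isTriv (fun i j => v (4 * i + j)) (pt 16) ⇾
      allIOb (exIOb (allQ4 (allQ4
        (sameEv 0 1 (pt 20) (pt 24) ⇿
          affine (fun i j => v (4 * i + j)) (pt 16) (pt 20) (pt 24))))))))))

/-- All observers are inertial observers. -/
def AxNoAcc : Fml 0 0 := .allB (ob 0 ⇾ .IOb 0)

/-- The axioms common to classical kinematics and special relativity. -/
def KinFull : Theory := {AxEField, AxEv, AxSelf, AxSymD, AxLine, AxTriv, AxNoAcc}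

/-- The time difference between any two events is the same for all inertial observers.
The four quadruples are `x, y, x', y'`. -/
def AxAbsTime : Fml 0 0 :=
  allIOb (allIOb (allQ4 (allQ4 (allQ4 (allQ4
    (sameEv 0 1 (pt 0) (pt 8) ⋏ sameEv 0 1 (pt 4) (pt 12) ⇾
      eqTime (pt 0) (pt 4) (pt 8) (pt 12)))))))

/-- There is an inertial observer, and inertial observers can move along any non-horizontal
straight line. -/
def AxThExpPlus : Fml 0 0 :=
  .exB (.IOb 0) ⋏
    allIOb (allQ4 (allQ4 ((v 0 ≐ v 4).neg ⇾ exIOb (.W 0 1 (pt 0) ⋏ .W 0 1 (pt 4)))))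

/-- There is at least one ether observer. -/
def AxEther : Fml 0 0 := .exB (ether 0)

/-- Classical kinematics. -/
def ClassicalKinFull : Theory := KinFull ∪ {AxAbsTime, AxThExpPlus, AxEther}

/-- For any inertial observer, the speed of light is the same everywhere and in every direction,
and it is possible to send out a light signal in any direction everywhere. -/
def AxPhc : Fml 0 0 := .exQ (isLightSpeed (v 0))

/-- There is an inertial observer, and inertial observers can move along any straight line of any
speed less than the speed of light.  The quadruples are `x, y`; the variable `8` is the speed of
light. -/
def AxThExp : Fml 0 0 :=
  .exB (.IOb 0) ⋏
    allIOb (allQ4 (allQ4 (.exQ (isLightSpeed (v 8) ⋏ timelike (v 8) (pt 0) (pt 4)) ⇾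
      exIOb (.W 0 1 (pt 0) ⋏ .W 0 1 (pt 4)))))

/-- Special relativity. -/
def SpecRelFull : Theory := KinFull ∪ {AxPhc, AxThExp}

end Kinematics

/-! A definitional equivalence would contain an interpretation of classical kinematics in special
relativity that keeps both sorts and equality, and such an interpretation is already impossible, by
counting orbits of bodies.

By soundness, an interpretation turns any model of special relativity into a model of classical
kinematics on the same bodies and quantities, with relations defined by formulas (`Models.struc`).
Definable relations are invariant, so every automorphism of the original model is an automorphism of
the new one (`IsAut.struc`).

Special relativity has a model over `ℝ` that is as homogeneous as possible: each body is an element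
of the Poincaré group together with a flag saying whether it is an observer or a light signal. Right
multiplication by group elements gives automorphisms that fix all quantities, and these are
transitive on observers and on signals, so there are at most two orbits of bodies
(`minkowskiStruc.exists_isAut`).

Every model of classical kinematics has at least three. Ether observers agree on the speed of light
and on all spatial distances (`lightSpeed_eq`, `spaceSq_eq`), so the speed of an observer relative
to the ether does not depend on the ether observer chosen (`sq_speed_eq`). An automorphism fixing
the quantities sends ether observers to ether observers and hence preserves this speed. Observers
with ether speeds 0, 1 and 2 exist and lie in different orbits (`false_of_two_orbits`). -/

namespace Kinematics

/-! ### Semantics -/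

/-- An interpretation of the language in which `B` is the set of bodies and `Q` the set of
quantities. -/
structure Struc (B Q : Type*) where
  add : Q → Q → Q
  mul : Q → Q → Q
  le : Q → Q → Prop
  IOb : B → Prop
  Ph : B → Prop
  W : B → B → (Fin 4 → Q) → Prop

namespace Struc

variable {B Q : Type*}

/-- The value of a term. -/
def tval (S : Struc B Q) {n : ℕ} (q : Fin n → Q) : QTerm n → Q
  | .var i => q i
  | .add s t => S.add (S.tval q s) (S.tval q t)
  | .mul s t => S.mul (S.tval q s) (S.tval q t)

/-- Satisfaction of a formula under a valuation of its variables. -/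
def Sat (S : Struc B Q) : {m n : ℕ} → Fml m n → (Fin m → B) → (Fin n → Q) → Prop
  | _, _, .falsum, _, _ => False
  | _, _, .eqB k b, β, _ => β k = β b
  | _, _, .eqQ s t, _, q => S.tval q s = S.tval q t
  | _, _, .le s t, _, q => S.le (S.tval q s) (S.tval q t)
  | _, _, .IOb k, β, _ => S.IOb (β k)
  | _, _, .Ph k, β, _ => S.Ph (β k)
  | _, _, .W k b x, β, q => S.W (β k) (β b) fun i => S.tval q (x i)
  | _, _, .imp φ ψ, β, q => S.Sat φ β q → S.Sat ψ β q
  | m, _, .allB φ, β, q => ∀ b, S.Sat φ (Fin.snoc (α := fun _ : Fin (m + 1) => B) β b) q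
  | _, n, .allQ φ, β, q => ∀ a, S.Sat φ β (Fin.snoc (α := fun _ : Fin (n + 1) => Q) q a)

variable (S : Struc B Q)

@[simp] theorem tval_var {n : ℕ} (q : Fin n → Q) (i : Fin n) : S.tval q (.var i) = q i := rfl

@[simp] theorem tval_add {n : ℕ} (q : Fin n → Q) (s t : QTerm n) :
    S.tval q (s + t) = S.add (S.tval q s) (S.tval q t) := rfl

@[simp] theorem tval_mul {n : ℕ} (q : Fin n → Q) (s t : QTerm n) :
    S.tval q (s * t) = S.mul (S.tval q s) (S.tval q t) := rfl

section

variable {m n : ℕ} (β : Fin m → B) (q : Fin n → Q)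

@[simp] theorem sat_falsum : ¬ S.Sat .falsum β q := id

@[simp] theorem sat_eqB (k b : Fin m) : S.Sat (.eqB k b) β q ↔ β k = β b := Iff.rfl

@[simp] theorem sat_eqQ (s t : QTerm n) : S.Sat (.eqQ s t) β q ↔ S.tval q s = S.tval q t := Iff.rfl

@[simp] theorem sat_le (s t : QTerm n) :
    S.Sat (.le s t) β q ↔ S.le (S.tval q s) (S.tval q t) := Iff.rfl

@[simp] theorem sat_IOb (k : Fin m) : S.Sat (.IOb k) β q ↔ S.IOb (β k) := Iff.rfl

@[simp] theorem sat_Ph (k : Fin m) : S.Sat (.Ph k) β q ↔ S.Ph (β k) := Iff.rfl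

@[simp] theorem sat_W (k b : Fin m) (x : Fin 4 → QTerm n) :
    S.Sat (.W k b x) β q ↔ S.W (β k) (β b) fun i => S.tval q (x i) := Iff.rfl

@[simp] theorem sat_imp (φ ψ : Fml m n) :
    S.Sat (.imp φ ψ) β q ↔ (S.Sat φ β q → S.Sat ψ β q) := Iff.rfl

@[simp] theorem sat_allB (φ : Fml (m + 1) n) :
    S.Sat (.allB φ) β q ↔ ∀ b, S.Sat φ (Fin.snoc (α := fun _ : Fin (m + 1) => B) β b) q := Iff.rfl

@[simp] theorem sat_allQ (φ : Fml m (n + 1)) :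
    S.Sat (.allQ φ) β q ↔ ∀ a, S.Sat φ β (Fin.snoc (α := fun _ : Fin (n + 1) => Q) q a) := Iff.rfl

@[simp] theorem sat_neg (φ : Fml m n) : S.Sat φ.neg β q ↔ ¬ S.Sat φ β q := Iff.rfl

@[simp] theorem sat_and (φ ψ : Fml m n) :
    S.Sat (φ.and ψ) β q ↔ S.Sat φ β q ∧ S.Sat ψ β q := by
  simp [Fml.and]

@[simp] theorem sat_or (φ ψ : Fml m n) :
    S.Sat (φ.or ψ) β q ↔ S.Sat φ β q ∨ S.Sat ψ β q := by
  simp only [Fml.or, sat_imp, sat_neg]; tauto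

@[simp] theorem sat_iff (φ ψ : Fml m n) :
    S.Sat (φ.iff ψ) β q ↔ (S.Sat φ β q ↔ S.Sat ψ β q) := by
  simp only [Fml.iff, sat_and, sat_imp]; tauto

@[simp] theorem sat_exB (φ : Fml (m + 1) n) :
    S.Sat (.exB φ) β q ↔ ∃ b, S.Sat φ (Fin.snoc (α := fun _ : Fin (m + 1) => B) β b) q := by
  simp [Fml.exB]

@[simp] theorem sat_exQ (φ : Fml m (n + 1)) :
    S.Sat (.exQ φ) β q ↔ ∃ a, S.Sat φ β (Fin.snoc (α := fun _ : Fin (n + 1) => Q) q a) := by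
  simp [Fml.exQ]

end

/-! ### Substitution -/

theorem tval_subst {n n' : ℕ} (τ : Fin n → QTerm n') (q : Fin n' → Q) (t : QTerm n) :
    S.tval q (t.subst τ) = S.tval (fun i => S.tval q (τ i)) t := by
  induction t with
  | var i => rfl
  | add s t hs ht => simp only [QTerm.subst, tval, hs, ht]
  | mul s t hs ht => simp only [QTerm.subst, tval, hs, ht]

theorem tval_lift {n : ℕ} (j : ℕ) (q : Fin (n + j) → Q) (t : QTerm n) :
    S.tval q (t.lift j) = S.tval (fun i => q (Fin.castAdd j i)) t :=
  S.tval_subst _ _ _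

theorem snoc_upB {m m' : ℕ} (σ : Fin m → Fin m') (β : Fin m' → B) (b : B) :
    (fun i => Fin.snoc (α := fun _ : Fin (m' + 1) => B) β b (Fml.upB σ i)) =
      Fin.snoc (α := fun _ : Fin (m + 1) => B) (fun i => β (σ i)) b := by
  funext i
  induction i using Fin.lastCases <;> simp [Fml.upB]

theorem snoc_upQ {n n' : ℕ} (τ : Fin n → QTerm n') (q : Fin n' → Q) (a : Q) :
    (fun i => S.tval (Fin.snoc (α := fun _ : Fin (n' + 1) => Q) q a) (Fml.upQ τ i)) =
      Fin.snoc (α := fun _ : Fin (n + 1) => Q) (fun i => S.tval q (τ i)) a := by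
  funext i
  induction i using Fin.lastCases with
  | last => simp [Fml.upQ]
  | cast i =>
    have h : ∀ j : Fin n', Fin.castAdd 1 j = j.castSucc := fun _ => rfl
    simp [Fml.upQ, tval_lift, h]

theorem sat_subst {m n m' n' : ℕ} (σ : Fin m → Fin m') (τ : Fin n → QTerm n') (φ : Fml m n)
    (β : Fin m' → B) (q : Fin n' → Q) :
    S.Sat (φ.subst σ τ) β q ↔ S.Sat φ (fun i => β (σ i)) (fun i => S.tval q (τ i)) := by
  induction φ generalizing m' n' with
  | falsum => rfl
  | eqB k b => rfl
  | eqQ s t => simp only [Fml.subst, sat_eqQ, tval_subst]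
  | le s t => simp only [Fml.subst, sat_le, tval_subst]
  | IOb k => rfl
  | Ph k => rfl
  | W k b x => simp only [Fml.subst, sat_W, tval_subst]
  | imp φ ψ hφ hψ => simp only [Fml.subst, sat_imp, hφ, hψ]
  | allB φ h => simp only [Fml.subst, sat_allB, h, snoc_upB]
  | allQ φ h => simp only [Fml.subst, sat_allQ, h, snoc_upQ]

theorem sat_weakenB {m n : ℕ} (φ : Fml m n) (β : Fin m → B) (b : B) (q : Fin n → Q) :
    S.Sat φ.weakenB (Fin.snoc (α := fun _ : Fin (m + 1) => B) β b) q ↔ S.Sat φ β q := by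
  simp [Fml.weakenB, sat_subst]

theorem sat_weakenQ {m n : ℕ} (φ : Fml m n) (β : Fin m → B) (q : Fin n → Q) (a : Q) :
    S.Sat φ.weakenQ β (Fin.snoc (α := fun _ : Fin (n + 1) => Q) q a) ↔ S.Sat φ β q := by
  simp [Fml.weakenQ, sat_subst]

theorem sat_instB {m n : ℕ} (φ : Fml (m + 1) n) (β : Fin m → B) (b : Fin m) (q : Fin n → Q) :
    S.Sat (φ.instB b) β q ↔ S.Sat φ (Fin.snoc (α := fun _ : Fin (m + 1) => B) β (β b)) q := by
  have h : (fun i => β (Fin.snoc (α := fun _ : Fin (m + 1) => Fin m) id b i)) =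
      Fin.snoc (α := fun _ : Fin (m + 1) => B) β (β b) := by
    funext i
    induction i using Fin.lastCases <;> simp
  simp [Fml.instB, sat_subst, h]

theorem sat_instQ {m n : ℕ} (φ : Fml m (n + 1)) (β : Fin m → B) (q : Fin n → Q) (t : QTerm n) :
    S.Sat (φ.instQ t) β q ↔
      S.Sat φ β (Fin.snoc (α := fun _ : Fin (n + 1) => Q) q (S.tval q t)) := by
  have h : (fun i => S.tval q (Fin.snoc (α := fun _ : Fin (n + 1) => QTerm n) QTerm.var t i)) =
      Fin.snoc (α := fun _ : Fin (n + 1) => Q) q (S.tval q t) := by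
    funext i
    induction i using Fin.lastCases <;> simp
  simp [Fml.instQ, sat_subst, h]

/-! ### Soundness -/

/-- Induction on the derivation. The valuation has to vary, because the rules introducing
quantifiers add a variable. Nonemptiness of the carriers is what the rules `nonemptyB` and
`nonemptyQ` require. -/
theorem sat_of_derivable [Nonempty B] [Nonempty Q] {m n : ℕ} {Γ : Set (Fml m n)} {φ : Fml m n}
    (h : Derivable Γ φ) (β : Fin m → B) (q : Fin n → Q) (hΓ : ∀ γ ∈ Γ, S.Sat γ β q) :
    S.Sat φ β q := by
  induction h with
  | hyp h => exact hΓ _ h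
  | impI _ ih =>
    intro hφ
    exact ih β q (by rintro γ (rfl | hγ); exacts [hφ, hΓ γ hγ])
  | impE _ _ ih₁ ih₂ => exact ih₁ β q hΓ (ih₂ β q hΓ)
  | contra _ ih =>
    by_contra hφ
    exact ih β q (by rintro γ (rfl | hγ); exacts [hφ, hΓ γ hγ])
  | allBI _ ih =>
    intro b
    refine ih _ q ?_
    rintro _ ⟨γ, hγ, rfl⟩
    exact (S.sat_weakenB γ β b q).2 (hΓ γ hγ)
  | allBE _ b ih => exact (S.sat_instB _ β b q).2 (ih β q hΓ _)
  | allQI _ ih =>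
    intro a
    refine ih β _ ?_
    rintro _ ⟨γ, hγ, rfl⟩
    exact (S.sat_weakenQ γ β q a).2 (hΓ γ hγ)
  | allQE _ t ih => exact (S.sat_instQ _ β q t).2 (ih β q hΓ _)
  | reflB b => rfl
  | replB φ _ _ ih₁ ih₂ =>
    rw [sat_instB, ← show β _ = β _ from ih₁ β q hΓ, ← sat_instB]
    exact ih₂ β q hΓ
  | reflQ t => rfl
  | replQ φ _ _ ih₁ ih₂ =>
    rw [sat_instQ, ← show S.tval q _ = S.tval q _ from ih₁ β q hΓ, ← sat_instQ]
    exact ih₂ β q hΓ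
  | nonemptyB => simp
  | nonemptyQ => simp

/-- `S` is a model of `Th`. -/
def Models (Th : Theory) : Prop := ∀ σ ∈ Th, S.Sat σ Fin.elim0 Fin.elim0

variable {S}

theorem Models.sat_of_proves [Nonempty B] [Nonempty Q] {Th : Theory} (hS : S.Models Th) {m n : ℕ}
    {φ : Fml m n} (h : Th.Proves φ) (β : Fin m → B) (q : Fin n → Q) : S.Sat φ β q := by
  refine S.sat_of_derivable h β q ?_
  rintro _ ⟨σ, hσ, rfl⟩
  rw [sat_subst]
  convert hS σ hσ using 1

variable (S)

/-! ### The structure defined by a translation -/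

theorem sat_sub {a c m n : ℕ} (φ : Fml a c) (k : Fin a → Fin m) (x : Fin c → Fin n)
    (β : Fin m → B) (q : Fin n → Q) :
    S.Sat (Translation.sub φ k x) β q ↔ S.Sat φ (fun i => β (k i)) (fun i => q (x i)) := by
  simp [Translation.sub, sat_subst]

/-- The translations of `x + y = z` and `x · y = z` define functions. -/
structure Functional (Tr : Translation) : Prop where
  add : ∀ x y, ∃! z, S.Sat Tr.add Fin.elim0 ![x, y, z]
  mul : ∀ x y, ∃! z, S.Sat Tr.mul Fin.elim0 ![x, y, z]

variable {S}

/-- The structure defined in `S` by the translation `Tr`. -/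
noncomputable def Functional.struc {Tr : Translation} (h : S.Functional Tr) : Struc B Q where
  add x y := (h.add x y).choose
  mul x y := (h.mul x y).choose
  le x y := S.Sat Tr.le Fin.elim0 ![x, y]
  IOb k := S.Sat Tr.IOb ![k] Fin.elim0
  Ph k := S.Sat Tr.Ph ![k] Fin.elim0
  W k b x := S.Sat Tr.W ![k, b] x

theorem Functional.sat_add_iff {Tr : Translation} (h : S.Functional Tr) (x y z : Q) :
    S.Sat Tr.add Fin.elim0 ![x, y, z] ↔ h.struc.add x y = z :=
  ⟨fun hz => ((h.add x y).choose_spec.2 z hz).symm,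
    by rintro rfl; exact (h.add x y).choose_spec.1⟩

theorem Functional.sat_mul_iff {Tr : Translation} (h : S.Functional Tr) (x y z : Q) :
    S.Sat Tr.mul Fin.elim0 ![x, y, z] ↔ h.struc.mul x y = z :=
  ⟨fun hz => ((h.mul x y).choose_spec.2 z hz).symm,
    by rintro rfl; exact (h.mul x y).choose_spec.1⟩

/-! ### Valuations extended by two or four values -/

theorem snoc₂_castAdd {n : ℕ} (q : Fin n → Q) (a b : Q) (i : Fin n) :
    Fin.snoc (α := fun _ : Fin (n + 1 + 1) => Q)
      (Fin.snoc (α := fun _ : Fin (n + 1) => Q) q a) b (Fin.castAdd 2 i) = q i := by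
  rw [show Fin.castAdd 2 i = i.castSucc.castSucc from rfl]; simp

theorem snoc₂_natAdd_zero {n : ℕ} (q : Fin n → Q) (a b : Q) :
    Fin.snoc (α := fun _ : Fin (n + 1 + 1) => Q)
      (Fin.snoc (α := fun _ : Fin (n + 1) => Q) q a) b (Fin.natAdd n (0 : Fin 2)) = a := by
  rw [show Fin.natAdd n (0 : Fin 2) = (Fin.last n).castSucc from rfl]; simp

theorem snoc₂_natAdd_one {n : ℕ} (q : Fin n → Q) (a b : Q) :
    Fin.snoc (α := fun _ : Fin (n + 1 + 1) => Q)
      (Fin.snoc (α := fun _ : Fin (n + 1) => Q) q a) b (Fin.natAdd n (1 : Fin 2)) = b := by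
  rw [show Fin.natAdd n (1 : Fin 2) = Fin.last (n + 1) from rfl]; simp

/-- The valuation `q` extended by the four values `x`. -/
def snoc₄ {n : ℕ} (q : Fin n → Q) (x : Fin 4 → Q) : Fin (n + 4) → Q :=
  Fin.snoc (α := fun _ : Fin (n + 4) => Q) (Fin.snoc (α := fun _ : Fin (n + 3) => Q)
    (Fin.snoc (α := fun _ : Fin (n + 2) => Q) (Fin.snoc (α := fun _ : Fin (n + 1) => Q) q
      (x 0)) (x 1)) (x 2)) (x 3)

theorem snoc₄_castAdd {n : ℕ} (q : Fin n → Q) (x : Fin 4 → Q) (i : Fin n) :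
    snoc₄ q x (Fin.castAdd 4 i) = q i := by
  rw [show Fin.castAdd 4 i = i.castSucc.castSucc.castSucc.castSucc from rfl]; simp [snoc₄]

theorem snoc₄_natAdd {n : ℕ} (q : Fin n → Q) (x : Fin 4 → Q) (i : Fin 4) :
    snoc₄ q x (Fin.natAdd n i) = x i := by
  fin_cases i
  · change snoc₄ q x (Fin.last n).castSucc.castSucc.castSucc = _
    simp [snoc₄]
  · change snoc₄ q x (Fin.last (n + 1)).castSucc.castSucc = _
    simp [snoc₄]
  · change snoc₄ q x (Fin.last (n + 2)).castSucc = _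
    simp [snoc₄]
  · change snoc₄ q x (Fin.last (n + 3)) = _
    simp [snoc₄]

theorem exists_fin_four {p : (Fin 4 → Q) → Prop} :
    (∃ a b c d, p ![a, b, c, d]) ↔ ∃ x, p x := by
  constructor
  · rintro ⟨a, b, c, d, h⟩; exact ⟨_, h⟩
  · rintro ⟨x, h⟩
    refine ⟨x 0, x 1, x 2, x 3, ?_⟩
    convert h using 1
    funext i; fin_cases i <;> rfl

theorem forall_fin_four {p : (Fin 4 → Q) → Prop} :
    (∀ a b c d, p ![a, b, c, d]) ↔ ∀ x, p x := by
  have := exists_fin_four (p := fun x => ¬ p x)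
  simpa only [← not_forall, not_iff_not] using this

theorem sat_exQ_four {m n : ℕ} (φ : Fml m (n + 4)) (β : Fin m → B) (q : Fin n → Q) :
    S.Sat (.exQ (.exQ (.exQ (.exQ φ)))) β q ↔ ∃ x, S.Sat φ β (snoc₄ q x) := by
  simp only [sat_exQ]
  exact exists_fin_four (p := fun x => S.Sat φ β (snoc₄ q x))

theorem sat_allQ_four {m n : ℕ} (φ : Fml m (n + 4)) (β : Fin m → B) (q : Fin n → Q) :
    S.Sat (.allQ (.allQ (.allQ (.allQ φ)))) β q ↔ ∀ x, S.Sat φ β (snoc₄ q x) := by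
  simp only [sat_allQ]
  exact forall_fin_four (p := fun x => S.Sat φ β (snoc₄ q x))

theorem comp_vec_three {α : Type*} (q : α → Q) (i j k : α) :
    (fun l => q (![i, j, k] l)) = ![q i, q j, q k] := by
  funext l; fin_cases l <;> rfl

theorem comp_vec_two {α : Type*} (q : α → Q) (i j : α) :
    (fun l => q (![i, j] l)) = ![q i, q j] := by
  funext l; fin_cases l <;> rfl

theorem comp_vec_one {α : Type*} (q : α → Q) (i : α) :
    (fun l => q (![i] l)) = ![q i] := by
  funext l; fin_cases l; rfl

theorem comp_elim0 {α : Type*} (q : α → Q) : (fun l => q (Fin.elim0 l)) = Fin.elim0 :=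
  Subsingleton.elim _ _

/-- The witnesses of the two existential quantifiers at each operation are forced to be the values
of the two subterms, so the unnested formula computes the term in the defined structure. -/
theorem Functional.sat_graph {Tr : Translation} (h : S.Functional Tr) {m n n' : ℕ} (t : QTerm n)
    (ρ : Fin n → Fin n') (z : Fin n') (β : Fin m → B) (q : Fin n' → Q) :
    S.Sat (Tr.graph t ρ z) β q ↔ h.struc.tval (fun i => q (ρ i)) t = q z := by
  induction t generalizing n' with
  | var i => rfl
  | add s t hs ht =>
    simp only [Translation.graph, sat_exQ, sat_and, hs, ht, sat_sub, snoc₂_castAdd,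
      comp_vec_three, comp_elim0, snoc₂_natAdd_zero, snoc₂_natAdd_one, h.sat_add_iff, tval]
    exact ⟨by rintro ⟨_, _, ⟨rfl, rfl⟩, h⟩; exact h, fun h => ⟨_, _, ⟨rfl, rfl⟩, h⟩⟩
  | mul s t hs ht =>
    simp only [Translation.graph, sat_exQ, sat_and, hs, ht, sat_sub, snoc₂_castAdd,
      comp_vec_three, comp_elim0, snoc₂_natAdd_zero, snoc₂_natAdd_one, h.sat_mul_iff, tval]
    exact ⟨by rintro ⟨_, _, ⟨rfl, rfl⟩, h⟩; exact h, fun h => ⟨_, _, ⟨rfl, rfl⟩, h⟩⟩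

theorem Functional.sat_atom₂ {Tr : Translation} (h : S.Functional Tr) {m n : ℕ} (φ : Fml 0 2)
    (s t : QTerm n) (β : Fin m → B) (q : Fin n → Q) :
    S.Sat (Tr.atom₂ φ s t) β q ↔
      S.Sat φ Fin.elim0 ![h.struc.tval q s, h.struc.tval q t] := by
  simp only [Translation.atom₂, sat_exQ, sat_and, h.sat_graph, sat_sub, snoc₂_castAdd,
    comp_vec_two, comp_elim0, snoc₂_natAdd_zero, snoc₂_natAdd_one]
  exact ⟨by rintro ⟨_, _, ⟨rfl, rfl⟩, h⟩; exact h, fun h => ⟨_, _, ⟨rfl, rfl⟩, h⟩⟩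

theorem Functional.sat_atomW {Tr : Translation} (h : S.Functional Tr) {m n : ℕ}
    (k b : Fin m) (x : Fin 4 → QTerm n) (β : Fin m → B) (q : Fin n → Q) :
    S.Sat (Tr.atomW k b x) β q ↔ h.struc.W (β k) (β b) fun i => h.struc.tval q (x i) := by
  rw [Translation.atomW, sat_exQ_four]
  simp only [sat_and, h.sat_graph, sat_sub, snoc₄_castAdd, snoc₄_natAdd, comp_vec_two]
  constructor
  · rintro ⟨u, h0, h1, h2, h3, hu⟩
    have hx : (fun i => h.struc.tval q (x i)) = u := by
      funext i; fin_cases i <;> assumption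
    rw [hx]; exact hu
  · exact fun hW => ⟨_, rfl, rfl, rfl, rfl, hW⟩

/-- Equality and quantifiers are left alone by a translation, so the defined structure has the same
carriers as `S` and only the atomic formulas need an argument. -/
theorem Functional.sat_tr {Tr : Translation} (h : S.Functional Tr) {m n : ℕ} (φ : Fml m n)
    (β : Fin m → B) (q : Fin n → Q) : S.Sat (Tr.tr φ) β q ↔ h.struc.Sat φ β q := by
  induction φ with
  | falsum => rfl
  | eqB k b => rfl
  | eqQ s t => rw [Translation.tr, h.sat_atom₂]; rfl
  | le s t => rw [Translation.tr, h.sat_atom₂]; rfl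
  | IOb k => rw [Translation.tr, sat_sub, comp_vec_one, comp_elim0]; rfl
  | Ph k => rw [Translation.tr, sat_sub, comp_vec_one, comp_elim0]; rfl
  | W k b x => rw [Translation.tr, h.sat_atomW]; rfl
  | imp φ ψ hφ hψ => simp only [Translation.tr, sat_imp, hφ, hψ]
  | allB φ hφ => simp only [Translation.tr, sat_allB, hφ]
  | allQ φ hφ => simp only [Translation.tr, sat_allQ, hφ]

end Struc

/-! ### Interpretations and models -/

theorem QTerm.lift_one_subst_snoc {n : ℕ} (t u : QTerm n) :
    (t.lift 1).subst (Fin.snoc (α := fun _ => QTerm n) QTerm.var u) = t := by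
  have h : ∀ j : Fin n, Fin.castAdd 1 j = j.castSucc := fun _ => rfl
  unfold QTerm.lift
  induction t with
  | var i => simp [QTerm.subst, h]
  | add s t hs ht => simp only [QTerm.subst, hs, ht]
  | mul s t hs ht => simp only [QTerm.subst, hs, ht]

/-- A theorem of pure logic. Its translation, for `t` a sum or a product, says that the translated
operation has a value. -/
theorem Theory.proves_exists_eq (Th : Theory) {n : ℕ} (t : QTerm n) :
    Th.Proves (m := 0) (Fml.exQ (.eqQ (t.lift 1) (.var (Fin.last n)))) := by
  refine .impI (.impE (φ := .eqQ t t) ?_ (.reflQ t))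
  have h := Derivable.allQE (.hyp (Set.mem_insert
    (Fml.allQ (Fml.eqQ (t.lift 1) (.var (Fin.last n))).neg)
    ((fun σ : Fml 0 0 => σ.subst (Fin.elim0 : Fin 0 → Fin 0)
      (Fin.elim0 : Fin 0 → QTerm n)) '' Th))) t
  simpa [Fml.instQ, Fml.neg, Fml.subst, QTerm.lift_one_subst_snoc, QTerm.subst] using h

/-- The counterpart for uniqueness of the value; it is Leibniz's law, rewriting `t` in the second
equation. -/
theorem Theory.proves_eq_of_eq (Th : Theory) {n : ℕ} (t : QTerm n) (i j : Fin n) :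
    Th.Proves (m := 0) (.imp (.eqQ t (.var i)) (.imp (.eqQ t (.var j))
      (.eqQ (.var i) (.var j)))) := by
  have hinst : ∀ u : QTerm n, (Fml.eqQ (m := 0) (.var (Fin.last n)) (.var j.castSucc)).instQ u =
      .eqQ u (.var j) := by
    intro u; simp [Fml.instQ, Fml.subst, QTerm.subst]
  refine .impI (.impI ?_)
  rw [← hinst (.var i)]
  refine .replQ _ (t := t) (.hyp (Set.mem_insert_of_mem _ (Set.mem_insert _ _))) ?_
  rw [hinst]
  exact .hyp (Set.mem_insert _ _)

namespace Struc

variable {B Q : Type*} [Nonempty B] [Nonempty Q] {S : Struc B Q} {Th₁ Th₂ : Theory}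
  {Tr : Translation}

/-- An interpretation carries theorems of pure logic to theorems, in particular the existence and
uniqueness of the value of a term. Since `sat_tr` presupposes `Functional`, the translated equations
are unfolded by hand here. -/
theorem Models.functional (hS : S.Models Th₁) (h : Tr.IsInterpretation Th₂ Th₁) :
    S.Functional Tr := by
  have hadd : ∀ {n : ℕ} (q : Fin n → Q) (i j k : Fin n),
      S.Sat (Tr.tr (.eqQ (m := 0) (.add (.var i) (.var j)) (.var k))) Fin.elim0 q ↔
        S.Sat Tr.add Fin.elim0 ![q i, q j, q k] := by
    intro n q i j k
    simp only [Translation.tr, Translation.atom₂, Translation.graph, sat_exQ, sat_and, sat_sub,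
      snoc₂_castAdd, comp_vec_three, comp_elim0, snoc₂_natAdd_zero, snoc₂_natAdd_one, sat_eqQ,
      tval_var, comp_vec_two, Matrix.cons_val_zero, Matrix.cons_val_one]
    exact ⟨by rintro ⟨_, _, ⟨⟨_, _, ⟨rfl, rfl⟩, h⟩, rfl⟩, rfl⟩; exact h,
      fun h => ⟨_, _, ⟨⟨_, _, ⟨rfl, rfl⟩, h⟩, rfl⟩, rfl⟩⟩
  have hmul : ∀ {n : ℕ} (q : Fin n → Q) (i j k : Fin n),
      S.Sat (Tr.tr (.eqQ (m := 0) (.mul (.var i) (.var j)) (.var k))) Fin.elim0 q ↔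
        S.Sat Tr.mul Fin.elim0 ![q i, q j, q k] := by
    intro n q i j k
    simp only [Translation.tr, Translation.atom₂, Translation.graph, sat_exQ, sat_and, sat_sub,
      snoc₂_castAdd, comp_vec_three, comp_elim0, snoc₂_natAdd_zero, snoc₂_natAdd_one, sat_eqQ,
      tval_var, comp_vec_two, Matrix.cons_val_zero, Matrix.cons_val_one]
    exact ⟨by rintro ⟨_, _, ⟨⟨_, _, ⟨rfl, rfl⟩, h⟩, rfl⟩, rfl⟩; exact h,
      fun h => ⟨_, _, ⟨⟨_, _, ⟨rfl, rfl⟩, h⟩, rfl⟩, rfl⟩⟩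
  have heq : ∀ {n : ℕ} (q : Fin n → Q) (i j : Fin n),
      S.Sat (Tr.tr (.eqQ (m := 0) (.var i) (.var j))) Fin.elim0 q ↔ q i = q j := by
    intro n q i j
    simp only [Translation.tr, Translation.atom₂, Translation.graph, sat_exQ, sat_and, sat_sub,
      snoc₂_castAdd, comp_elim0, snoc₂_natAdd_zero, snoc₂_natAdd_one, sat_eqQ,
      tval_var, comp_vec_two, Matrix.cons_val_zero, Matrix.cons_val_one]
    exact ⟨by rintro ⟨_, _, ⟨rfl, rfl⟩, h⟩; exact h, fun h => ⟨_, _, ⟨rfl, rfl⟩, h⟩⟩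
  have hex : ∀ t : QTerm 2, ∀ x y, ∃ z, S.Sat (Tr.tr (.eqQ (m := 0) (t.lift 1)
      (.var (Fin.last 2)))) Fin.elim0 (Fin.snoc (α := fun _ : Fin 3 => Q) ![x, y] z) := by
    intro t x y
    have := hS.sat_of_proves (h 0 2 _ (Th₂.proves_exists_eq t)) Fin.elim0 ![x, y]
    rw [Fml.exQ, Fml.neg, Fml.neg, Translation.tr, Translation.tr, Translation.tr,
      Translation.tr] at this
    exact (S.sat_exQ _ _ _).1 this
  have huniq : ∀ (t : QTerm 4) (q : Fin 4 → Q) (i j : Fin 4),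
      S.Sat (Tr.tr (.eqQ (m := 0) t (.var i))) Fin.elim0 q →
      S.Sat (Tr.tr (.eqQ (m := 0) t (.var j))) Fin.elim0 q → q i = q j := by
    intro t q i j hi hj
    have := hS.sat_of_proves (h 0 4 _ (Th₂.proves_eq_of_eq t i j)) Fin.elim0 q
    rw [Translation.tr, Translation.tr] at this
    exact (heq q i j).1 (this hi hj)
  constructor
  · intro x y
    obtain ⟨z, hz⟩ := hex (.add (.var 0) (.var 1)) x y
    have hz' := (hadd _ 0 1 2).1 hz
    refine ⟨z, hz', fun w hw => ?_⟩
    -- The two candidate values are placed in the valuation as variables 2 and 3.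
    exact huniq (.add (.var 0) (.var 1)) ![x, y, w, z] 2 3
      ((hadd _ _ _ _).2 hw) ((hadd _ _ _ _).2 hz')
  · intro x y
    obtain ⟨z, hz⟩ := hex (.mul (.var 0) (.var 1)) x y
    have hz' := (hmul _ 0 1 2).1 hz
    refine ⟨z, hz', fun w hw => ?_⟩
    exact huniq (.mul (.var 0) (.var 1)) ![x, y, w, z] 2 3
      ((hmul _ _ _ _).2 hw) ((hmul _ _ _ _).2 hz')

/-- An axiom of `Th₂` is a theorem of `Th₂`, so its translation holds in `S`, and `sat_tr` reads
this as the axiom itself in the defined structure. -/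
theorem Models.struc (hS : S.Models Th₁) (h : Tr.IsInterpretation Th₂ Th₁) :
    (hS.functional h).struc.Models Th₂ := by
  intro σ hσ
  have h₁ := hS.sat_of_proves (h 0 0 _ (.hyp ⟨σ, hσ, rfl⟩)) Fin.elim0 Fin.elim0
  rw [(hS.functional h).sat_tr, sat_subst] at h₁
  convert h₁ using 1

end Struc

/-! ### Automorphisms -/

namespace Struc

variable {B Q : Type*}

/-- The permutation `π` of the bodies, together with the identity on the quantities, is an
automorphism of `S`. -/
structure IsAut (S : Struc B Q) (π : Equiv.Perm B) : Prop where
  IOb : ∀ k, S.IOb (π k) ↔ S.IOb k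
  Ph : ∀ p, S.Ph (π p) ↔ S.Ph p
  W : ∀ k b x, S.W (π k) (π b) x ↔ S.W k b x

variable {S : Struc B Q} {π : Equiv.Perm B}

/-- Terms denote quantities, which do not move; a quantifier over bodies is reindexed along `π`. -/
theorem IsAut.sat_iff (h : S.IsAut π) {m n : ℕ} (φ : Fml m n) (β : Fin m → B) (q : Fin n → Q) :
    S.Sat φ (fun i => π (β i)) q ↔ S.Sat φ β q := by
  induction φ with
  | falsum => rfl
  | eqB k b => exact π.injective.eq_iff
  | eqQ s t => rfl
  | le s t => rfl
  | IOb k => exact h.IOb _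
  | Ph k => exact h.Ph _
  | W k b x => exact h.W _ _ _
  | imp φ ψ hφ hψ => simp only [sat_imp, hφ, hψ]
  | @allB m n φ hφ =>
    rw [sat_allB, sat_allB, ← π.forall_congr_right]
    refine forall_congr' fun b => ?_
    rw [← hφ (Fin.snoc (α := fun _ : Fin (m + 1) => B) β b)]
    refine iff_of_eq (congrArg (fun β' => S.Sat φ β' q) ?_)
    funext i
    induction i using Fin.lastCases <;> simp
  | allQ φ hφ => simp only [sat_allQ, hφ]

/-- Passing to a definable structure can only enlarge the automorphism group. -/
theorem IsAut.struc (h : S.IsAut π) {Tr : Translation} (hTr : S.Functional Tr) :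
    hTr.struc.IsAut π where
  IOb k := by
    have := h.sat_iff Tr.IOb ![k] Fin.elim0
    rwa [comp_vec_one] at this
  Ph k := by
    have := h.sat_iff Tr.Ph ![k] Fin.elim0
    rwa [comp_vec_one] at this
  W k b x := by
    have := h.sat_iff Tr.W ![k, b] x
    rwa [comp_vec_two] at this

end Struc


namespace Struc

variable {B Q : Type*}

/-! ### Evaluation of variables and lifted terms -/

theorem snoc_of_lt {n : ℕ} (q : Fin n → Q) (a : Q) {i : ℕ} (h : i < n + 1) (hi : i < n) :
    Fin.snoc (α := fun _ : Fin (n + 1) => Q) q a ⟨i, h⟩ = q ⟨i, hi⟩ := by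
  simp [Fin.snoc, hi, Fin.castLT]

theorem snoc_of_eq {n : ℕ} (q : Fin n → Q) (a : Q) {i : ℕ} (h : i < n + 1) (hi : i = n) :
    Fin.snoc (α := fun _ : Fin (n + 1) => Q) q a ⟨i, h⟩ = a := by
  simp [Fin.snoc, hi]

theorem snoc₄_of_lt {n : ℕ} (q : Fin n → Q) (x : Fin 4 → Q) {i : ℕ} (h : i < n + 4) (hi : i < n) :
    snoc₄ q x ⟨i, h⟩ = q ⟨i, hi⟩ :=
  snoc₄_castAdd q x ⟨i, hi⟩

variable (S : Struc B Q) {m n : ℕ} (β : Fin m → B) (q : Fin n → Q)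

theorem tval_v (i : ℕ) (h : i < n) : S.tval q (v i h) = q ⟨i, h⟩ := rfl

theorem tval_lift_one (a : Q) (t : QTerm n) :
    S.tval (Fin.snoc (α := fun _ : Fin (n + 1) => Q) q a) (t.lift 1) = S.tval q t := by
  have h : ∀ j : Fin n, Fin.castAdd 1 j = j.castSucc := fun _ => rfl
  simp [tval_lift, h]

theorem tval_lift_two (a b : Q) (t : QTerm n) :
    S.tval (Fin.snoc (α := fun _ : Fin (n + 1 + 1) => Q)
      (Fin.snoc (α := fun _ : Fin (n + 1) => Q) q a) b) (t.lift 2) = S.tval q t := by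
  have h : ∀ j : Fin n, Fin.castAdd 2 j = j.castSucc.castSucc := fun _ => rfl
  refine (S.tval_lift 2 _ t).trans ?_; simp [h]

theorem tval_lift_three (a b c : Q) (t : QTerm n) :
    S.tval (Fin.snoc (α := fun _ : Fin (n + 1 + 1 + 1) => Q)
      (Fin.snoc (α := fun _ : Fin (n + 1 + 1) => Q)
        (Fin.snoc (α := fun _ : Fin (n + 1) => Q) q a) b) c) (t.lift 3) = S.tval q t := by
  have h : ∀ j : Fin n, Fin.castAdd 3 j = j.castSucc.castSucc.castSucc := fun _ => rfl
  refine (S.tval_lift 3 _ t).trans ?_; simp [h]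

theorem tval_lift_four (x : Fin 4 → Q) (t : QTerm n) :
    S.tval (snoc₄ q x) (t.lift 4) = S.tval q t := by
  rw [tval_lift]; simp only [snoc₄_castAdd]

theorem tval_lift_sixteen (x y z w : Fin 4 → Q) (t : QTerm n) :
    S.tval (snoc₄ (snoc₄ (snoc₄ (snoc₄ q x) y) z) w) (t.lift 16) = S.tval q t := by
  have h : ∀ j : Fin n, Fin.castAdd 16 j =
    Fin.castAdd 4 (Fin.castAdd 4 (Fin.castAdd 4 (Fin.castAdd 4 j))) := fun _ => rfl
  refine (S.tval_lift 16 _ t).trans ?_; simp only [h, snoc₄_castAdd]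

/-- The value of a quadruple of terms. -/
def pval (x : Fin 4 → QTerm n) : Fin 4 → Q := fun i => S.tval q (x i)

theorem pval_liftPt_one (a : Q) (x : Fin 4 → QTerm n) :
    S.pval (Fin.snoc (α := fun _ : Fin (n + 1) => Q) q a) (liftPt 1 x) = S.pval q x :=
  funext fun i => S.tval_lift_one q a (x i)

theorem pval_liftPt_two (a b : Q) (x : Fin 4 → QTerm n) :
    S.pval (Fin.snoc (α := fun _ : Fin (n + 1 + 1) => Q)
      (Fin.snoc (α := fun _ : Fin (n + 1) => Q) q a) b) (liftPt 2 x) = S.pval q x :=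
  funext fun i => S.tval_lift_two q a b (x i)

theorem pval_liftPt_sixteen (x y z w : Fin 4 → Q) (p : Fin 4 → QTerm n) :
    S.pval (snoc₄ (snoc₄ (snoc₄ (snoc₄ q x) y) z) w) (liftPt 16 p) = S.pval q p :=
  funext fun i => S.tval_lift_sixteen q x y z w (p i)

theorem pval_pt_of_lt (x : Fin 4 → Q) {i : ℕ} (h : i + 4 ≤ n + 4) (hi : i + 4 ≤ n) :
    S.pval (snoc₄ q x) (pt i h) = S.pval q (pt i hi) :=
  funext fun j => snoc₄_of_lt q x _ (show i + j.val < n by omega)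

theorem pval_pt_of_eq (x : Fin 4 → Q) {i : ℕ} (h : i + 4 ≤ n + 4) (hi : i = n) :
    S.pval (snoc₄ q x) (pt i h) = x := by
  subst hi; exact funext fun j => snoc₄_natAdd q x j

theorem sat_W_pval (k b : Fin m) (x : Fin 4 → QTerm n) :
    S.Sat (.W k b x) β q ↔ S.W (β k) (β b) (S.pval q x) := Iff.rfl

/-! ### Evaluation of the abbreviations -/

theorem sat_allQ4 (φ : Fml m (n + 4)) :
    S.Sat (allQ4 φ) β q ↔ ∀ x, S.Sat φ β (snoc₄ q x) := sat_allQ_four φ β q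

theorem sat_exQ4 (φ : Fml m (n + 4)) :
    S.Sat (exQ4 φ) β q ↔ ∃ x, S.Sat φ β (snoc₄ q x) := sat_exQ_four φ β q

theorem sat_allIOb (φ : Fml (m + 1) n) :
    S.Sat (allIOb φ) β q ↔
      ∀ k, S.IOb k → S.Sat φ (Fin.snoc (α := fun _ : Fin (m + 1) => B) β k) q := by
  simp [allIOb]

theorem sat_exIOb (φ : Fml (m + 1) n) :
    S.Sat (exIOb φ) β q ↔
      ∃ k, S.IOb k ∧ S.Sat φ (Fin.snoc (α := fun _ : Fin (m + 1) => B) β k) q := by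
  simp [exIOb]

theorem sat_exPh (φ : Fml (m + 1) n) :
    S.Sat (exPh φ) β q ↔
      ∃ k, S.Ph k ∧ S.Sat φ (Fin.snoc (α := fun _ : Fin (m + 1) => B) β k) q := by
  simp [exPh]

theorem sat_isZero (t : QTerm n) :
    S.Sat (isZero t) β q ↔ ∀ a, S.add a (S.tval q t) = a := by
  simp [isZero, tval_lift_one, tval_v, snoc_of_eq]

theorem sat_isOne (t : QTerm n) :
    S.Sat (isOne t) β q ↔ ∀ a, S.mul a (S.tval q t) = a := by
  simp [isOne, tval_lift_one, tval_v, snoc_of_eq]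

theorem sat_nonneg (t : QTerm n) :
    S.Sat (nonneg t) β q ↔ ∃ z, (∀ a, S.add a z = a) ∧ S.le z (S.tval q t) := by
  simp [nonneg, sat_isZero, tval_lift_one, tval_v, snoc_of_eq]

theorem sat_pos (t : QTerm n) :
    S.Sat (pos t) β q ↔ ∃ z, (∀ a, S.add a z = a) ∧ S.le z (S.tval q t) ∧ z ≠ S.tval q t := by
  simp [pos, lt, sat_isZero, tval_lift_one, tval_v, snoc_of_eq]

/-- `ev_k(x) = ev_h(y)`. -/
def SameEv (k h : B) (x y : Fin 4 → Q) : Prop := ∀ b, S.W k b x ↔ S.W h b y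

theorem sat_sameEv (k h : Fin m) (x y : Fin 4 → QTerm n) :
    S.Sat (sameEv k h x y) β q ↔ S.SameEv (β k) (β h) (S.pval q x) (S.pval q y) := by
  simp only [sameEv, SameEv, sat_allB, sat_iff, sat_W_pval, Fin.snoc_castSucc, Fin.snoc_last]

/-- Formulated with the bare operations, because the field structure on `Q` is still to be
constructed from these conditions. -/
theorem sat_AxEField : S.Sat AxEField Fin.elim0 Fin.elim0 ↔
    (∀ a b c, S.add (S.add a b) c = S.add a (S.add b c)) ∧
    (∀ a b, S.add a b = S.add b a) ∧
    (∃ z, ∀ a, S.add a z = a) ∧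
    (∀ a, ∃ b, ∀ c, S.add c (S.add a b) = c) ∧
    (∀ a b c, S.mul (S.mul a b) c = S.mul a (S.mul b c)) ∧
    (∀ a b, S.mul a b = S.mul b a) ∧
    (∃ e, (∀ a, S.mul a e = a) ∧ ¬ ∀ a, S.add a e = a) ∧
    (∀ a, (¬ ∀ c, S.add c a = c) → ∃ b, ∀ c, S.mul c (S.mul a b) = c) ∧
    (∀ a b c, S.mul a (S.add b c) = S.add (S.mul a b) (S.mul a c)) ∧
    (∀ a, S.le a a) ∧
    (∀ a b, S.le a b ∧ S.le b a → a = b) ∧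
    (∀ a b c, S.le a b ∧ S.le b c → S.le a c) ∧
    (∀ a b, S.le a b ∨ S.le b a) ∧
    (∀ a b c, S.le a b → S.le (S.add a c) (S.add b c)) ∧
    (∀ a b, (∃ z, (∀ c, S.add c z = c) ∧ S.le z a) ∧ (∃ z, (∀ c, S.add c z = c) ∧ S.le z b) →
      ∃ z, (∀ c, S.add c z = c) ∧ S.le z (S.mul a b)) ∧
    (∀ a, (∃ z, (∀ c, S.add c z = c) ∧ S.le z a ∧ z ≠ a) → ∃ b, S.mul b b = a) := by
  simp +decide only [AxEField, sat_isZero, sat_isOne, sat_nonneg, sat_pos, tval_v, snoc_of_eq,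
    snoc_of_lt, sat_and, sat_or, sat_neg, sat_imp, sat_eqQ, sat_le, sat_allQ, sat_exQ, tval_add,
    tval_mul]

theorem sat_AxEv : S.Sat AxEv Fin.elim0 Fin.elim0 ↔
    ∀ k h, S.IOb k → S.IOb h → ∀ x, ∃ y, S.SameEv k h x y := by
  simp +decide only [AxEv, sat_allIOb, sat_allQ4, sat_exQ4, sat_sameEv, pval_pt_of_lt,
    pval_pt_of_eq]
  exact ⟨fun h k l hk hl => h k hk l hl, fun h k hk l hl => h k l hk hl⟩

theorem sat_AxNoAcc : S.Sat AxNoAcc Fin.elim0 Fin.elim0 ↔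
    ∀ k, (∃ b x, S.W k b x) → S.IOb k := by
  simp only [AxNoAcc, ob, sat_allB, sat_imp, sat_exB, sat_exQ4, sat_W_pval, pval_pt_of_eq]
  rfl

theorem sat_AxThExpPlus : S.Sat AxThExpPlus Fin.elim0 Fin.elim0 ↔
    (∃ k, S.IOb k) ∧ ∀ k, S.IOb k → ∀ x y, x 0 ≠ y 0 → ∃ h, S.IOb h ∧ S.W k h x ∧ S.W k h y := by
  simp +decide only [AxThExpPlus, sat_allIOb, sat_exIOb, sat_allQ4, sat_imp, sat_and, sat_W_pval,
    sat_neg, sat_eqQ, pval_pt_of_eq, pval_pt_of_lt, sat_exB, sat_IOb]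
  rfl

/-! ### Structures over an ordered field -/

/-- The quantities of the structure form the ordered field `K`. -/
class IsOverField {K : Type*} [Field K] [LinearOrder K] (S : Struc B K) : Prop where
  add_eq (a b : K) : S.add a b = a + b
  mul_eq (a b : K) : S.mul a b = a * b
  le_iff (a b : K) : S.le a b ↔ a ≤ b

open IsOverField

/-- The square of the spatial distance. -/
def spaceSq {K : Type*} [Field K] (x y : Fin 4 → K) : K :=
  (x 1 - y 1) ^ 2 + (x 2 - y 2) ^ 2 + (x 3 - y 3) ^ 2

section OverField

variable {K : Type*} [Field K] [LinearOrder K] (S : Struc B K) [S.IsOverField]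
  {m n : ℕ} (β : Fin m → B) (q : Fin n → K)

theorem sat_isZero_iff (t : QTerm n) : S.Sat (isZero t) β q ↔ S.tval q t = 0 := by
  simp [sat_isZero, add_eq]

theorem sat_nonneg_iff (t : QTerm n) : S.Sat (nonneg t) β q ↔ 0 ≤ S.tval q t := by
  simp [sat_nonneg, add_eq, le_iff]

theorem sat_pos_iff (t : QTerm n) : S.Sat (pos t) β q ↔ 0 < S.tval q t := by
  simp [sat_pos, add_eq, le_iff, lt_iff_le_and_ne]

theorem sat_lt (s t : QTerm n) : S.Sat (lt s t) β q ↔ S.tval q s < S.tval q t := by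
  simp [lt, le_iff, lt_iff_le_and_ne]

theorem sat_isSpace (s : QTerm n) (x y : Fin 4 → QTerm n) :
    S.Sat (isSpace s x y) β q ↔
      0 ≤ S.tval q s ∧ S.tval q s ^ 2 = spaceSq (S.pval q x) (S.pval q y) := by
  simp only [isSpace, sat_exQ, sat_and, sat_eqQ, tval_add, tval_mul, liftPt, tval_lift_three,
    sat_nonneg_iff, add_eq, mul_eq, tval_v]
  simp only [snoc_of_eq, snoc_of_lt, Nat.lt_succ_self, lt_add_iff_pos_right,
    Nat.succ_pos, Nat.add_assoc, Nat.reduceAdd]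
  simp only [← eq_sub_iff_add_eq, spaceSq, pval, ← pow_two]
  exact ⟨by rintro ⟨_, _, _, rfl, rfl, rfl, h⟩; exact h, fun h => ⟨_, _, _, rfl, rfl, rfl, h⟩⟩

theorem sat_isTime [IsStrictOrderedRing K] (t : QTerm n) (x y : Fin 4 → QTerm n) :
    S.Sat (isTime t x y) β q ↔ S.tval q t = |S.pval q x 0 - S.pval q y 0| := by
  simp only [isTime, sat_exQ, sat_and, sat_or, sat_eqQ, tval_add, liftPt, tval_lift_one,
    sat_nonneg_iff, sat_isZero_iff, add_eq, tval_v, snoc_of_eq]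
  simp only [← eq_sub_iff_add_eq, pval, exists_eq_left]
  rw [zero_sub]
  constructor
  · rintro ⟨h₀, h | h⟩
    · rw [h] at h₀ ⊢; exact (abs_of_nonneg h₀).symm
    · rw [← abs_neg, ← h, abs_of_nonneg h₀]
  · intro h
    exact ⟨h ▸ abs_nonneg _, h ▸ abs_choice _⟩

/-- The affine map `x ↦ A x + r`. -/
def affineMap (A : Fin 4 → Fin 4 → K) (r x : Fin 4 → K) : Fin 4 → K :=
  fun i => A i 0 * x 0 + A i 1 * x 1 + A i 2 * x 2 + A i 3 * x 3 + r i

theorem sat_affine (A : Fin 4 → Fin 4 → QTerm n) (r x x' : Fin 4 → QTerm n) :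
    S.Sat (affine A r x x') β q ↔
      S.pval q x' = affineMap (fun i => S.pval q (A i)) (S.pval q r) (S.pval q x) := by
  simp only [affine, sat_and, sat_eqQ, tval_add, tval_mul, add_eq, mul_eq, funext_iff,
    Fin.forall_fin_succ, affineMap, pval]
  simp

theorem sat_AxSelf : S.Sat AxSelf Fin.elim0 Fin.elim0 ↔
    ∀ k, S.IOb k → ∀ x, S.W k k x ↔ x 1 = 0 ∧ x 2 = 0 ∧ x 3 = 0 := by
  simp +decide only [AxSelf, sat_allIOb, sat_allQ4, sat_iff, sat_and, sat_W_pval, pval_pt_of_eq,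
    sat_isZero_iff, tval_v]
  rfl

theorem sat_AxLine : S.Sat AxLine Fin.elim0 Fin.elim0 ↔
    ∀ k h, S.IOb k → S.IOb h → ∀ x y z, S.W k h x → S.W k h y → S.W k h z → ∃ a,
      (∀ i, z i + a * x i = a * y i + x i) ∨ (∀ i, y i + a * x i = a * z i + z i) := by
  simp +decide only [AxLine, sat_allIOb, sat_allQ4, sat_imp, sat_and, sat_W_pval,
    pval_pt_of_eq, pval_pt_of_lt, sat_exQ, sat_or, sat_eqQ, tval_add, tval_mul, add_eq, mul_eq]
  constructor
  · intro H k h hk hh x y z hx hy hz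
    obtain ⟨a, ha | ha⟩ := H k hk h hh x y z ⟨hx, hy, hz⟩
    · refine ⟨a, .inl fun i => ?_⟩
      fin_cases i
      exacts [ha.1, ha.2.1, ha.2.2.1, ha.2.2.2]
    · refine ⟨a, .inr fun i => ?_⟩
      fin_cases i
      exacts [ha.1, ha.2.1, ha.2.2.1, ha.2.2.2]
  · rintro H k hk h hh x y z ⟨hx, hy, hz⟩
    obtain ⟨a, ha | ha⟩ := H k h hk hh x y z hx hy hz
    · exact ⟨a, .inl ⟨ha 0, ha 1, ha 2, ha 3⟩⟩
    · exact ⟨a, .inr ⟨ha 0, ha 1, ha 2, ha 3⟩⟩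

/-- Nonnegative quantities have square roots. -/
def HasSqrt (K : Type*) [Field K] [LinearOrder K] : Prop := ∀ a : K, 0 ≤ a → ∃ s, 0 ≤ s ∧ s ^ 2 = a

theorem spaceSq_nonneg [IsStrictOrderedRing K] (x y : Fin 4 → K) :
    0 ≤ spaceSq x y := by
  unfold spaceSq; positivity

theorem eq_of_sat_eqSpace (x y x' y' : Fin 4 → QTerm n) (h : S.Sat (eqSpace x y x' y') β q) :
    spaceSq (S.pval q x) (S.pval q y) = spaceSq (S.pval q x') (S.pval q y') := by
  simp only [eqSpace, sat_exQ, sat_and, sat_isSpace, pval_liftPt_one] at h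
  obtain ⟨s, ⟨-, h₁⟩, -, h₂⟩ := h
  exact h₁.symm.trans h₂

/-- The formula asserts that the common distance exists as a quantity; `HasSqrt` supplies it. -/
theorem sat_eqSpace [IsStrictOrderedRing K] (hK : HasSqrt K) (x y x' y' : Fin 4 → QTerm n) :
    S.Sat (eqSpace x y x' y') β q ↔
      spaceSq (S.pval q x) (S.pval q y) = spaceSq (S.pval q x') (S.pval q y') := by
  refine ⟨S.eq_of_sat_eqSpace β q x y x' y', fun h => ?_⟩
  simp only [eqSpace, sat_exQ, sat_and, sat_isSpace, pval_liftPt_one, tval_v, snoc_of_eq, ← h]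
  obtain ⟨s, hs⟩ := hK _ (spaceSq_nonneg (S.pval q x) (S.pval q y))
  exact ⟨s, hs, hs⟩

variable [IsStrictOrderedRing K]

theorem sat_eqTime (x y x' y' : Fin 4 → QTerm n) :
    S.Sat (eqTime x y x' y') β q ↔
      |S.pval q x 0 - S.pval q y 0| = |S.pval q x' 0 - S.pval q y' 0| := by
  simp [eqTime, sat_isTime, pval_liftPt_one, tval_v, snoc_of_eq]

theorem sat_eqTimeZero (x y x' y' : Fin 4 → QTerm n) :
    S.Sat (eqTimeZero x y x' y') β q ↔
      S.pval q x 0 = S.pval q y 0 ∧ S.pval q x' 0 = S.pval q y' 0 := by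
  simp only [eqTimeZero, sat_exQ, sat_and, sat_isTime, sat_isZero_iff, pval_liftPt_one, tval_v,
    snoc_of_eq]
  rw [← sub_eq_zero, ← abs_eq_zero, ← sub_eq_zero (a := S.pval q x' 0), ← abs_eq_zero (a := _ - _)]
  exact ⟨by rintro ⟨a, h₁, h₂, rfl⟩; exact ⟨h₁.symm, h₂.symm⟩,
    fun h => ⟨0, h.1.symm, h.2.symm, rfl⟩⟩

/-- No root has to be extracted: if the squared equation holds, `c * |x₀ - y₀|` itself is the
distance, being nonnegative because `c` is positive. -/
theorem sat_lightlike (c : QTerm n) (x y : Fin 4 → QTerm n) (hc : 0 < S.tval q c) :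
    S.Sat (lightlike c x y) β q ↔ spaceSq (S.pval q x) (S.pval q y) =
      (S.tval q c * (S.pval q x 0 - S.pval q y 0)) ^ 2 := by
  simp only [lightlike, sat_exQ, sat_and, sat_isSpace, sat_isTime, pval_liftPt_two, tval_lift_two,
    sat_eqQ, tval_mul, mul_eq, tval_v]
  simp only [snoc_of_eq, snoc_of_lt, Nat.lt_succ_self]
  constructor
  · rintro ⟨_, _, ⟨-, h⟩, rfl, rfl⟩
    rw [← h, mul_pow, mul_pow, sq_abs]
  · intro h
    refine ⟨_, _, ⟨?_, ?_⟩, rfl, rfl⟩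
    · positivity
    · rw [h, mul_pow, mul_pow, sq_abs]

theorem lt_of_sat_timelike (c : QTerm n) (x y : Fin 4 → QTerm n)
    (h : S.Sat (timelike c x y) β q) : spaceSq (S.pval q x) (S.pval q y) <
      (S.tval q c * (S.pval q x 0 - S.pval q y 0)) ^ 2 := by
  simp only [timelike, sat_exQ, sat_and, sat_isSpace, sat_isTime, pval_liftPt_two, tval_lift_two,
    sat_lt, tval_mul, mul_eq, tval_v] at h
  simp only [snoc_of_eq, snoc_of_lt, Nat.lt_succ_self] at h
  obtain ⟨s, _, ⟨h₀, h⟩, rfl, hlt⟩ := h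
  rw [← h, mul_pow, ← sq_abs (_ - _), ← mul_pow]
  exact pow_lt_pow_left₀ hlt h₀ two_ne_zero

/-- `c` is the speed of light for `k`. -/
def LightSpeedFor (k : B) (c : K) : Prop :=
  ∀ x y, (∃ p, S.Ph p ∧ S.W k p x ∧ S.W k p y) ↔ spaceSq x y = (c * (x 0 - y 0)) ^ 2

theorem sat_lightSpeedFor (k : Fin m) (c : QTerm n) (hc : 0 < S.tval q c) :
    S.Sat (lightSpeedFor k c) β q ↔ S.LightSpeedFor (β k) (S.tval q c) := by
  simp only [lightSpeedFor, sat_allQ4, sat_iff, sat_exPh, sat_and, sat_W_pval, Fin.snoc_castSucc,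
    Fin.snoc_last, LightSpeedFor]
  refine forall_congr' fun x => forall_congr' fun y => ?_
  rw [sat_lightlike]
  · simp only [pval_pt_of_eq, pval_pt_of_lt, le_refl, tval_lift_four]
  · simpa only [tval_lift_four] using hc

theorem sat_isLightSpeed (c : QTerm n) :
    S.Sat (isLightSpeed c) β q ↔
      0 < S.tval q c ∧ ∀ k, S.IOb k → S.LightSpeedFor k (S.tval q c) := by
  simp only [isLightSpeed, sat_and, sat_pos_iff, sat_allIOb]
  refine and_congr_right fun hc => forall_congr' fun k => imp_congr_right fun _ => ?_
  rw [sat_lightSpeedFor _ _ _ _ _ hc, Fin.snoc_last]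

theorem sat_ether (e : Fin m) :
    S.Sat (ether e) β q ↔ S.IOb (β e) ∧ ∃ c, 0 < c ∧ S.LightSpeedFor (β e) c := by
  simp only [ether, sat_and, sat_IOb, sat_exQ, sat_pos_iff]
  refine and_congr_right fun _ => exists_congr fun c => ?_
  simp only [tval_v, snoc_of_eq]
  refine and_congr_right fun hc => ?_
  rw [sat_lightSpeedFor]
  · simp only [tval_v, snoc_of_eq]
  · simpa only [tval_v, snoc_of_eq] using hc

theorem sat_isTriv (hK : HasSqrt K) (A : Fin 4 → Fin 4 → QTerm n) (r : Fin 4 → QTerm n) :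
    S.Sat (isTriv A r) β q ↔
      ∀ x y, affineMap (fun i => S.pval q (A i)) (S.pval q r) x 0 = x 0 + S.pval q r 0 ∧
        spaceSq x y = spaceSq (affineMap (fun i => S.pval q (A i)) (S.pval q r) x)
          (affineMap (fun i => S.pval q (A i)) (S.pval q r) y) := by
  have hpt : ∀ x y x' y' : Fin 4 → K,
      S.pval (snoc₄ (snoc₄ (snoc₄ (snoc₄ q x) y) x') y') (pt n) = x ∧
      S.pval (snoc₄ (snoc₄ (snoc₄ (snoc₄ q x) y) x') y') (pt (n + 4)) = y ∧
      S.pval (snoc₄ (snoc₄ (snoc₄ (snoc₄ q x) y) x') y') (pt (n + 8)) = x' ∧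
      S.pval (snoc₄ (snoc₄ (snoc₄ (snoc₄ q x) y) x') y') (pt (n + 12)) = y' := by
    intro x y x' y'
    refine ⟨?_, ?_, ?_, ?_⟩
    · rw [pval_pt_of_lt _ _ _ _ (by omega), pval_pt_of_lt _ _ _ _ (by omega),
        pval_pt_of_lt _ _ _ _ (by omega), pval_pt_of_eq _ _ _ _ rfl]
    · rw [pval_pt_of_lt _ _ _ _ (by omega), pval_pt_of_lt _ _ _ _ (by omega),
        pval_pt_of_eq _ _ _ _ rfl]
    · rw [pval_pt_of_lt _ _ _ _ (by omega), pval_pt_of_eq _ _ _ _ rfl]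
    · rw [pval_pt_of_eq _ _ _ _ rfl]
  have hA : ∀ x y x' y' : Fin 4 → K, ∀ i,
      S.pval (snoc₄ (snoc₄ (snoc₄ (snoc₄ q x) y) x') y') (fun j => (A i j).lift 16) =
        S.pval q (A i) := fun x y x' y' i => S.pval_liftPt_sixteen q x y x' y' (A i)
  have h₀ : ∀ x y x' y' : Fin 4 → K,
      S.tval (snoc₄ (snoc₄ (snoc₄ (snoc₄ q x) y) x') y') (v n) = x 0 := fun x y x' y' =>
    congrFun (hpt x y x' y').1 0
  have h₈ : ∀ x y x' y' : Fin 4 → K,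
      S.tval (snoc₄ (snoc₄ (snoc₄ (snoc₄ q x) y) x') y') (v (n + 8)) = x' 0 := fun x y x' y' =>
    congrFun (hpt x y x' y').2.2.1 0
  have hr : ∀ x y x' y' : Fin 4 → K,
      S.tval (snoc₄ (snoc₄ (snoc₄ (snoc₄ q x) y) x') y') (liftPt 16 r 0) = S.pval q r 0 :=
    fun x y x' y' => congrFun (S.pval_liftPt_sixteen q x y x' y' r) 0
  simp only [isTriv, sat_allQ4, sat_imp, sat_and, sat_affine, sat_eqQ, S.sat_eqSpace _ _ hK,
    sat_eqQ, tval_add, add_eq, hpt, hA, pval_liftPt_sixteen, h₀, h₈, hr]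
  exact ⟨fun h x y => h x y _ _ ⟨rfl, rfl⟩, by rintro h x y _ _ ⟨rfl, rfl⟩; exact h x y⟩

/-! ### Evaluation of the axioms -/

theorem sat_AxSymD (hK : HasSqrt K) : S.Sat AxSymD Fin.elim0 Fin.elim0 ↔
    ∀ k h, S.IOb k → S.IOb h → ∀ x y x' y', x 0 = y 0 → x' 0 = y' 0 → S.SameEv k h x x' →
      S.SameEv k h y y' → spaceSq x y = spaceSq x' y' := by
  simp +decide only [AxSymD, sat_allIOb, sat_allQ4, sat_imp, sat_and, sat_sameEv, sat_eqTimeZero,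
    S.sat_eqSpace _ _ hK, pval_pt_of_eq, pval_pt_of_lt]
  exact ⟨fun H k h hk hh x y x' y' h₁ h₂ h₃ h₄ => H k hk h hh x y x' y' ⟨⟨h₁, h₂⟩, h₃, h₄⟩,
    fun H k hk h hh x y x' y' ⟨⟨h₁, h₂⟩, h₃, h₄⟩ => H k h hk hh x y x' y' h₁ h₂ h₃ h₄⟩

/-- One implication suffices: this axiom is verified in the Minkowski model, and the classical part
of the argument does not draw on it. -/
theorem sat_AxTriv_of (hK : HasSqrt K)
    (H : ∀ (A : Fin 4 → Fin 4 → K) (r : Fin 4 → K),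
      (∀ x y, affineMap A r x 0 = x 0 + r 0 ∧
        spaceSq x y = spaceSq (affineMap A r x) (affineMap A r y)) →
      ∀ k, S.IOb k → ∃ h, S.IOb h ∧ ∀ x x', S.SameEv k h x x' ↔ x' = affineMap A r x) :
    S.Sat AxTriv Fin.elim0 Fin.elim0 := by
  simp +decide only [AxTriv, sat_allIOb, sat_exIOb, sat_allQ4, sat_imp, sat_iff, sat_sameEv,
    S.sat_isTriv _ _ hK, sat_affine, pval_pt_of_eq, pval_pt_of_lt]
  intro a₀ a₁ a₂ a₃ r hT k hk
  -- The first sixteen quantity variables list the matrix row by row.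
  have h₁ : (fun i : Fin 4 => S.pval (snoc₄ (snoc₄ (snoc₄ (snoc₄ (snoc₄ Fin.elim0 a₀) a₁) a₂) a₃) r)
      fun j => v (4 * i.val + j.val)) = ![a₀, a₁, a₂, a₃] := by
    funext i j; fin_cases i <;> fin_cases j <;> rfl
  have h₂ : ∀ x x' : Fin 4 → K, (fun i : Fin 4 => S.pval (snoc₄ (snoc₄ (snoc₄ (snoc₄ (snoc₄ (snoc₄
      (snoc₄ Fin.elim0 a₀) a₁) a₂) a₃) r) x) x') fun j => v (4 * i.val + j.val)) =
        ![a₀, a₁, a₂, a₃] := by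
    intro x x'; funext i j; fin_cases i <;> fin_cases j <;> rfl
  rw [h₁] at hT
  obtain ⟨h, hh, hW⟩ := H ![a₀, a₁, a₂, a₃] r hT k hk
  refine ⟨h, hh, fun x x' => ?_⟩
  rw [h₂]
  exact hW x x'

theorem sat_AxAbsTime : S.Sat AxAbsTime Fin.elim0 Fin.elim0 ↔
    ∀ k h, S.IOb k → S.IOb h → ∀ x y x' y', S.SameEv k h x x' → S.SameEv k h y y' →
      |x 0 - y 0| = |x' 0 - y' 0| := by
  simp +decide only [AxAbsTime, sat_allIOb, sat_allQ4, sat_imp, sat_and, sat_sameEv, sat_eqTime,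
    pval_pt_of_eq, pval_pt_of_lt]
  exact ⟨fun H k h hk hh x y x' y' h₁ h₂ => H k hk h hh x y x' y' ⟨h₁, h₂⟩,
    fun H k hk h hh x y x' y' ⟨h₁, h₂⟩ => H k h hk hh x y x' y' h₁ h₂⟩

theorem sat_AxEther : S.Sat AxEther Fin.elim0 Fin.elim0 ↔
    ∃ e, S.IOb e ∧ ∃ c, 0 < c ∧ S.LightSpeedFor e c := by
  simp only [AxEther, sat_exB, sat_ether]
  rfl

theorem sat_AxPhc : S.Sat AxPhc Fin.elim0 Fin.elim0 ↔
    ∃ c, 0 < c ∧ ∀ k, S.IOb k → S.LightSpeedFor k c := by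
  simp only [AxPhc, sat_exQ, sat_isLightSpeed, tval_v, snoc_of_eq]

theorem sat_AxThExp_of (h₀ : ∃ k, S.IOb k)
    (h : ∀ c, 0 < c → (∀ k, S.IOb k → S.LightSpeedFor k c) → ∀ k, S.IOb k →
      ∀ x y, spaceSq x y < (c * (x 0 - y 0)) ^ 2 → ∃ h, S.IOb h ∧ S.W k h x ∧ S.W k h y) :
    S.Sat AxThExp Fin.elim0 Fin.elim0 := by
  simp +decide only [AxThExp, sat_allIOb, sat_exIOb, sat_allQ4, sat_imp, sat_and, sat_W_pval,
    sat_exQ, sat_isLightSpeed, pval_pt_of_eq, pval_pt_of_lt, sat_exB, sat_IOb]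
  refine ⟨h₀, ?_⟩
  rintro k hk x y ⟨c, ⟨hc, hL⟩, ht⟩
  exact h c hc hL k hk x y (S.lt_of_sat_timelike _ _ _ _ _ ht)

end OverField

end Struc


namespace Struc

variable {B : Type*}

/-! ### The ordered field of quantities -/

/-- The model obtained from a translation may carry operations different from the usual ones on `Q`,
so the instances are built from the axioms. -/
theorem exists_isOverField {Q : Type*} (S : Struc B Q)
    (h : S.Sat AxEField Fin.elim0 Fin.elim0) :
    ∃ (_ : Field Q) (_ : LinearOrder Q), IsStrictOrderedRing Q ∧ S.IsOverField ∧ HasSqrt Q := by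
  classical
  obtain ⟨hadda, haddc, ⟨z, hz⟩, hneg, hmula, hmulc, ⟨e, he, hez⟩, hinv, hdist, hrefl, hanti, htrans,
    htotal, hle, hmul, hsqrt⟩ := S.sat_AxEField.1 h
  -- The formulas mention neutral elements only through their defining property; uniqueness
  -- identifies them all with `z` and `e`.
  have hzero : ∀ w, (∀ a, S.add a w = a) → w = z := fun w hw => by
    rw [← hz w, haddc, hw]
  have hone : ∀ w, (∀ a, S.mul a w = a) → w = e := fun w hw => by
    rw [← he w, hmulc, hw]
  choose neg hneg using hneg
  have hmul0 : ∀ a, S.mul a z = z := by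
    intro a
    refine hzero _ fun b => ?_
    have h₁ : S.add (S.mul a z) (S.mul a z) = S.mul a z := by rw [← hdist, hz]
    have h₂ := hneg (S.mul a z) (S.mul a z)
    rw [← hadda, h₁] at h₂
    rw [← h₂]; exact hneg _ b
  let R : CommRing Q :=
    { add := S.add
      mul := S.mul
      zero := z
      one := e
      neg := neg
      add_assoc := hadda
      add_comm := haddc
      zero_add := fun a => (haddc z a).trans (hz a)
      add_zero := hz
      mul_assoc := hmula
      mul_comm := hmulc
      one_mul := fun a => (hmulc e a).trans (he a)
      mul_one := he
      left_distrib := hdist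
      right_distrib := fun a b c => by
        change S.mul (S.add a b) c = S.add (S.mul a c) (S.mul b c)
        rw [hmulc, hdist, hmulc c a, hmulc c b]
      zero_mul := fun a => (hmulc z a).trans (hmul0 a)
      mul_zero := hmul0
      neg_add_cancel := fun a => by
        change S.add (neg a) a = z
        rw [haddc]; exact hzero _ fun c => hneg a c
      nsmul := @nsmulRec _ ⟨z⟩ ⟨S.add⟩
      zsmul := @zsmulRec _ ⟨z⟩ ⟨S.add⟩ ⟨neg⟩ (@nsmulRec _ ⟨z⟩ ⟨S.add⟩) }
  have hne : e ≠ z := fun h => hez fun a => by rw [h, hz]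
  have hF : IsField Q :=
    { exists_pair_ne := ⟨e, z, hne⟩
      mul_comm := hmulc
      mul_inv_cancel := fun {a} ha => by
        obtain ⟨b, hb⟩ := hinv a fun H => ha (hzero a H)
        exact ⟨b, hone _ hb⟩ }
  let F : Field Q := hF.toField
  let L : LinearOrder Q :=
    { le := S.le
      le_refl := hrefl
      le_trans := fun a b c h₁ h₂ => htrans a b c ⟨h₁, h₂⟩
      le_antisymm := fun a b h₁ h₂ => hanti a b ⟨h₁, h₂⟩
      le_total := htotal
      toDecidableLE := Classical.decRel _ }
  have hO : IsOrderedAddMonoid Q :=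
    { add_le_add_left := fun a b h c => hle a b c h }
  have hnn : ∀ a b : Q, 0 ≤ a → 0 ≤ b → 0 ≤ a * b := by
    intro a b ha hb
    obtain ⟨w, hw, hab⟩ := hmul a b ⟨⟨z, hz, ha⟩, ⟨z, hz, hb⟩⟩
    rw [hzero w hw] at hab
    exact hab
  have h01 : ZeroLEOneClass Q := by
    -- If `1 ≤ 0`, then `0 ≤ -1`, and squaring gives `0 ≤ 1` anyway.
    refine ⟨(le_total (0 : Q) 1).elim id fun h => ?_⟩
    have h' : (0 : Q) ≤ -1 := by simpa using add_le_add_left h (-1)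
    simpa using hnn _ _ h' h'
  have hS : IsStrictOrderedRing Q := .of_mul_pos fun a b ha hb =>
    lt_of_le_of_ne (hnn a b ha.le hb.le) (mul_ne_zero ha.ne' hb.ne').symm
  refine ⟨F, L, hS, ⟨fun _ _ => rfl, fun _ _ => rfl, fun _ _ => Iff.rfl⟩, fun a ha => ?_⟩
  rcases ha.eq_or_lt with rfl | ha
  · exact ⟨0, le_rfl, by simp⟩
  · obtain ⟨b, hb⟩ := hsqrt a ⟨z, hz, ha.le, ha.ne⟩
    exact ⟨|b|, abs_nonneg b, by rw [sq_abs, pow_two]; exact hb⟩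

/-! ### Speeds relative to the ether -/

section Classical

variable {K : Type*} [Field K] [LinearOrder K] [IsStrictOrderedRing K] {S : Struc B K}

/-- The semantic content of the axioms of classical kinematics about speeds relative to the ether. -/
structure IsClassical (S : Struc B K) : Prop where
  ev : ∀ k h, S.IOb k → S.IOb h → ∀ x, ∃ y, S.SameEv k h x y
  symD : ∀ k h, S.IOb k → S.IOb h → ∀ x y x' y', x 0 = y 0 → x' 0 = y' 0 → S.SameEv k h x x' →
    S.SameEv k h y y' → spaceSq x y = spaceSq x' y'
  line : ∀ k h, S.IOb k → S.IOb h → ∀ x y z, S.W k h x → S.W k h y → S.W k h z → ∃ a,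
    (∀ i, z i + a * x i = a * y i + x i) ∨ (∀ i, y i + a * x i = a * z i + z i)
  absTime : ∀ k h, S.IOb k → S.IOb h → ∀ x y x' y', S.SameEv k h x x' → S.SameEv k h y y' →
    |x 0 - y 0| = |x' 0 - y' 0|
  thExp : ∀ k, S.IOb k → ∀ x y, x 0 ≠ y 0 → ∃ h, S.IOb h ∧ S.W k h x ∧ S.W k h y
  ether : ∃ e, S.IOb e ∧ ∃ c, 0 < c ∧ S.LightSpeedFor e c

/-- The body `k` passes through the origin of the coordinate system of `e` and moves with the
speed `|v|` along the first axis. -/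
def HasSpeed (S : Struc B K) (e k : B) (v : K) : Prop :=
  S.W e k ![0, 0, 0, 0] ∧ S.W e k ![1, v, 0, 0]

namespace IsClassical

variable (hS : S.IsClassical) {e e' : B} {c c' : K}

include hS

/-- An event `x` and the ends `a`, `b` of a diameter, with centre `z`, of a section of its light
cone are described by two ether observers. -/
theorem exists_diameter (he : S.IOb e) (he' : S.IOb e') (hc : S.LightSpeedFor e c)
    (hc' : S.LightSpeedFor e' c') {x x' z z' : Fin 4 → K} (hx : S.SameEv e e' x x')
    (hz : S.SameEv e e' z z') (h₁ : z 1 = x 1) (h₂ : z 2 = x 2) (h₃ : z 3 = x 3) :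
    ∃ a b : Fin 4 → K, a 0 = z' 0 ∧ b 0 = z' 0 ∧
      spaceSq a b = 4 * (c * (z 0 - x 0)) ^ 2 ∧
      spaceSq a z' = (c * (z 0 - x 0)) ^ 2 ∧ spaceSq b z' = (c * (z 0 - x 0)) ^ 2 ∧
      spaceSq a x' = (c' * (z 0 - x 0)) ^ 2 ∧ spaceSq b x' = (c' * (z 0 - x 0)) ^ 2 := by
  have htime : ∀ {y y'}, S.SameEv e e' y y' → y 0 = z 0 → y' 0 = z' 0 := by
    intro y y' hy h
    have := hS.absTime e e' he he' y z y' z' hy hz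
    rw [h, sub_self, abs_zero, eq_comm, abs_eq_zero, sub_eq_zero] at this
    exact this
  -- A light signal joins `y` and `x`. The observer `e'` sees it with speed `c'`, over the same
  -- absolute time difference.
  have hlight : ∀ {y y'}, S.SameEv e e' y y' → y 0 = z 0 →
      spaceSq y x = (c * (z 0 - x 0)) ^ 2 → spaceSq y' x' = (c' * (z 0 - x 0)) ^ 2 := by
    intro y y' hy h0 h
    obtain ⟨p, hp, hpy, hpx⟩ := (hc y x).2 (by rw [h, h0])
    rw [(hc' y' x').1 ⟨p, hp, (hy p).1 hpy, (hx p).1 hpx⟩, mul_pow, mul_pow, ← sq_abs (_ - _),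
      ← hS.absTime e e' he he' y x y' x' hy hx, sq_abs, h0]
  -- For `e`, the light cone of `x` at the time of `z` is a sphere about `z`, since `z` is at the
  -- place of `x`. The two events chosen are opposite points of it in the direction of the first
  -- axis.
  obtain ⟨a, ha⟩ := hS.ev e e' he he' ![z 0, z 1 + c * (z 0 - x 0), z 2, z 3]
  obtain ⟨b, hb⟩ := hS.ev e e' he he' ![z 0, z 1 - c * (z 0 - x 0), z 2, z 3]
  have ha0 := htime ha rfl
  have hb0 := htime hb rfl
  refine ⟨a, b, ha0, hb0, ?_, ?_, ?_, hlight ha rfl ?_, hlight hb rfl ?_⟩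
  · rw [← hS.symD e e' he he' _ _ _ _ (by rfl) (ha0.trans hb0.symm) ha hb]
    simp [spaceSq]; ring
  · rw [← hS.symD e e' he he' _ _ _ _ (by rfl) ha0 ha hz]
    simp [spaceSq]
  · rw [← hS.symD e e' he he' _ _ _ _ (by rfl) hb0 hb hz]
    simp [spaceSq]
  · simp [spaceSq, h₁, h₂, h₃]
  · simp [spaceSq, h₁, h₂, h₃]

/-- Light emitted from one place reaches the ends of a diameter of length `2c` after unit time. The
ends are simultaneous, so `e'` also measures `2c` between them, while for `e'` both are at distance
`c'` from the source. The triangle inequality gives `2c ≤ 2c'`. -/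
theorem lightSpeed_le (he : S.IOb e) (he' : S.IOb e') (h0' : 0 < c')
    (hc : S.LightSpeedFor e c) (hc' : S.LightSpeedFor e' c') : c ≤ c' := by
  obtain ⟨x', hx⟩ := hS.ev e e' he he' ![0, 0, 0, 0]
  obtain ⟨z', hz⟩ := hS.ev e e' he he' ![1, 0, 0, 0]
  obtain ⟨a, b, -, -, hab, -, -, hax, hbx⟩ := hS.exists_diameter he he' hc hc' hx hz rfl rfl rfl
  simp only [spaceSq, Matrix.cons_val_zero, sub_zero, mul_one] at hab hax hbx
  refine le_of_sq_le_sq ?_ h0'.le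
  -- The parallelogram identity for the vectors from `x'` to `a` and to `b`.
  nlinarith [sq_nonneg (a 1 - x' 1 + (b 1 - x' 1)), sq_nonneg (a 2 - x' 2 + (b 2 - x' 2)),
    sq_nonneg (a 3 - x' 3 + (b 3 - x' 3))]

theorem lightSpeed_eq (he : S.IOb e) (he' : S.IOb e') (h0 : 0 < c) (h0' : 0 < c')
    (hc : S.LightSpeedFor e c) (hc' : S.LightSpeedFor e' c') : c = c' :=
  le_antisymm (hS.lightSpeed_le he he' h0' hc hc') (hS.lightSpeed_le he' he h0 hc' hc)

/-- Ether observers agree on spatial distances. -/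
theorem spaceSq_eq (he : S.IOb e) (he' : S.IOb e') (h0 : 0 < c) (h0' : 0 < c')
    (hc : S.LightSpeedFor e c) (hc' : S.LightSpeedFor e' c') {x y x' y' : Fin 4 → K}
    (hx : S.SameEv e e' x x') (hy : S.SameEv e e' y y') : spaceSq x y = spaceSq x' y' := by
  obtain rfl := hS.lightSpeed_eq he he' h0 h0' hc hc'
  -- For `e`, the event `z` is at the place of `x` and at the time of `y`. The aim is that `e'` also
  -- sees `z` at the place of `x`, i.e. that the two observers are at relative rest; then `AxSymD`
  -- applies to `z` and `y`.
  obtain ⟨z', hz⟩ := hS.ev e e' he he' ![y 0, x 1, x 2, x 3]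
  obtain ⟨a, b, -, -, hab, haz, hbz, hax, hbx⟩ := hS.exists_diameter he he' hc hc' hx hz rfl rfl rfl
  have hzy : z' 0 = y' 0 := by
    have := hS.absTime e e' he he' _ _ _ _ hz hy
    simp only [Matrix.cons_val_zero, sub_self, abs_zero] at this
    rwa [eq_comm, abs_eq_zero, sub_eq_zero] at this
  -- A point whose distance from both ends of a segment is half its length is the midpoint, by the
  -- parallelogram identity. As the light speeds agree, this applies to both `z'` and `x'`.
  have hmid : ∀ u : Fin 4 → K, 4 * spaceSq a u = spaceSq a b → spaceSq b u = spaceSq a u →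
      a 1 + b 1 = 2 * u 1 ∧ a 2 + b 2 = 2 * u 2 ∧ a 3 + b 3 = 2 * u 3 := by
    intro u hau hbu
    have h : (a 1 + b 1 - 2 * u 1) ^ 2 + (a 2 + b 2 - 2 * u 2) ^ 2 + (a 3 + b 3 - 2 * u 3) ^ 2 =
        0 := by
      simp only [spaceSq] at hau hbu
      linear_combination 2 * hbu + hau
    have h₁ := sq_nonneg (a 1 + b 1 - 2 * u 1)
    have h₂ := sq_nonneg (a 2 + b 2 - 2 * u 2)
    have h₃ := sq_nonneg (a 3 + b 3 - 2 * u 3)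
    refine ⟨?_, ?_, ?_⟩ <;> rw [← sub_eq_zero] <;> refine pow_eq_zero_iff two_ne_zero |>.1 ?_ <;>
      linarith
  obtain ⟨m₁, m₂, m₃⟩ := hmid z' (by rw [haz, hab]) (by rw [haz, hbz])
  obtain ⟨l₁, l₂, l₃⟩ := hmid x' (by rw [hax, hab]) (by rw [hax, hbx])
  have hsp := hS.symD e e' he he' _ _ _ _ (by rfl) hzy hz hy
  have hz₁ : z' 1 = x' 1 := by linarith
  have hz₂ : z' 2 = x' 2 := by linarith
  have hz₃ : z' 3 = x' 3 := by linarith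
  simpa [spaceSq, hz₁, hz₂, hz₃] using hsp

/-- An inertial observer has the same speed relative to all ether observers. -/
theorem sq_speed_eq (he : S.IOb e) (he' : S.IOb e') (h0 : 0 < c) (h0' : 0 < c')
    (hc : S.LightSpeedFor e c) (hc' : S.LightSpeedFor e' c') {k : B} (hk : S.IOb k) {v w : K}
    (hv : S.HasSpeed e k v) (hw : S.HasSpeed e' k w) : v ^ 2 = w ^ 2 := by
  -- The two events by which `e'` measures the speed `w`, in the coordinates of `e`.
  obtain ⟨x, hx⟩ := hS.ev e' e he' he ![0, 0, 0, 0]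
  obtain ⟨y, hy⟩ := hS.ev e' e he' he ![1, w, 0, 0]
  have hspace := hS.spaceSq_eq he' he h0' h0 hc' hc hx hy
  have htime := hS.absTime e' e he' he _ _ _ _ hx hy
  -- By `AxLine` the worldline of `k` for `e` lies on the line through the two points that define
  -- `v`.
  have key : ∀ z, S.W e k z → z 1 = v * z 0 ∧ z 2 = 0 ∧ z 3 = 0 := by
    intro z hz
    obtain ⟨a, ha | ha⟩ := hS.line e k he hk _ _ z hv.1 hv.2 hz
    · have h₀ := ha 0
      have h₁ := ha 1
      have h₂ := ha 2
      have h₃ := ha 3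
      simp at h₀ h₁ h₂ h₃
      exact ⟨by rw [h₀, h₁, mul_comm], h₂, h₃⟩
    · have h₀ := ha 0
      have h₁ := ha 1
      have h₂ := ha 2
      have h₃ := ha 3
      simp at h₀ h₁ h₂ h₃
      -- The time component of the second alternative reads `1 = (a + 1) z₀`.
      have hne : a + 1 ≠ 0 := by
        intro h
        have : (1 : K) = (a + 1) * z 0 := by linear_combination h₀
        rw [h, zero_mul] at this
        exact one_ne_zero this
      refine ⟨?_, ?_, ?_⟩ <;> apply mul_left_cancel₀ hne
      · linear_combination v * h₀ - h₁
      · linear_combination -h₂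
      · linear_combination -h₃
  obtain ⟨x₁, x₂, x₃⟩ := key x ((hx k).1 hw.1)
  obtain ⟨y₁, y₂, y₃⟩ := key y ((hy k).1 hw.2)
  have ht : (x 0 - y 0) ^ 2 = 1 := by
    rw [← sq_abs, ← htime]; simp
  simp only [spaceSq, x₁, x₂, x₃, y₁, y₂, y₃] at hspace
  simp at hspace
  linear_combination -hspace - v ^ 2 * ht

/-- There are at least three orbits of bodies under the automorphisms that fix the quantities. -/
theorem false_of_two_orbits (f : B → Bool)
    (hf : ∀ b b', f b = f b' → ∃ π, S.IsAut π ∧ π b = b') : False := by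
  obtain ⟨e, he, c, h0, hc⟩ := hS.ether
  have hk : ∀ v : K, ∃ k, S.IOb k ∧ S.HasSpeed e k v := fun v =>
    hS.thExp e he ![0, 0, 0, 0] ![1, v, 0, 0] (by simp)
  choose k hk hspeed using hk
  -- The automorphism makes `π e` an ether observer with the same `c`, relative to which `π (k v) =
  -- k w` has speed `v`; relative to `e` it has speed `w`.
  have hinj : ∀ v w, f (k v) = f (k w) → v ^ 2 = w ^ 2 := by
    intro v w h
    obtain ⟨π, hπ, hvw⟩ := hf _ _ h
    refine (hS.sq_speed_eq (e' := π e) he ((hπ.IOb e).2 he) h0 h0 hc ?_ (hk w) (hspeed w)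
      ⟨?_, ?_⟩).symm
    · intro x y
      rw [← hc x y, ← π.exists_congr_right]
      simp only [hπ.Ph, hπ.W]
    · rw [← hvw, hπ.W]; exact (hspeed v).1
    · rw [← hvw, hπ.W]; exact (hspeed v).2
  -- Three speeds with distinct squares, but only two values of `f`.
  have h₁ := hinj 0 1
  have h₂ := hinj 0 2
  have h₃ := hinj 1 2
  norm_num at h₁ h₂ h₃
  cases h : f (k 0) <;> simp_all

end IsClassical

end Classical

theorem Models.isClassical {K : Type*} [Field K] [LinearOrder K] [IsStrictOrderedRing K]
    {S : Struc B K} [S.IsOverField] (hK : HasSqrt K) (h : S.Models ClassicalKinFull) :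
    S.IsClassical where
  ev := S.sat_AxEv.1 (h _ (by simp [ClassicalKinFull, KinFull]))
  symD := (S.sat_AxSymD hK).1 (h _ (by simp [ClassicalKinFull, KinFull]))
  line := S.sat_AxLine.1 (h _ (by simp [ClassicalKinFull, KinFull]))
  absTime := S.sat_AxAbsTime.1 (h _ (by simp [ClassicalKinFull, KinFull]))
  thExp := (S.sat_AxThExpPlus.1 (h _ (by simp [ClassicalKinFull, KinFull]))).2
  ether := S.sat_AxEther.1 (h _ (by simp [ClassicalKinFull, KinFull]))

/-- In no model of classical kinematics do the automorphisms that fix the quantities have at most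
two orbits of bodies. -/
theorem Models.false_of_two_orbits {Q : Type*} {S : Struc B Q} (h : S.Models ClassicalKinFull)
    (f : B → Bool) (hf : ∀ b b', f b = f b' → ∃ π, S.IsAut π ∧ π b = b') : False := by
  obtain ⟨_, _, _, _, hK⟩ := S.exists_isOverField (h _ (by simp [ClassicalKinFull, KinFull]))
  exact (h.isClassical hK).false_of_two_orbits f hf

end Struc


open Struc

/-! ### The Poincaré group -/

/-- The Minkowski quadratic form. -/
def minkowski (x : Fin 4 → ℝ) : ℝ := x 0 ^ 2 - x 1 ^ 2 - x 2 ^ 2 - x 3 ^ 2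

theorem minkowski_sub (x y : Fin 4 → ℝ) : minkowski (x - y) = (x 0 - y 0) ^ 2 - spaceSq x y := by
  simp only [minkowski, spaceSq, Pi.sub_apply]; ring

/-- The group of all affine transformations that preserve the Minkowski form. -/
def Poincare : Subgroup ((Fin 4 → ℝ) ≃ᵃ[ℝ] (Fin 4 → ℝ)) where
  carrier := {f | ∀ x y, minkowski (f x - f y) = minkowski (x - y)}
  mul_mem' {f g} hf hg x y := (hf _ _).trans (hg _ _)
  one_mem' _ _ := rfl
  inv_mem' {f} hf x y := by
    have h := hf (f⁻¹ x) (f⁻¹ y)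
    rwa [show f (f⁻¹ x) = x from f.apply_symm_apply x, show f (f⁻¹ y) = y from f.apply_symm_apply y,
      eq_comm] at h

namespace Poincare

instance : CoeFun Poincare fun _ => (Fin 4 → ℝ) → (Fin 4 → ℝ) := ⟨fun g => g.1⟩

theorem minkowski_apply_sub (g : Poincare) (x y : Fin 4 → ℝ) :
    minkowski (g x - g y) = minkowski (x - y) := g.2 x y

theorem mul_apply (g h : Poincare) (x : Fin 4 → ℝ) : (g * h) x = g (h x) := rfl

theorem inv_apply_self (g : Poincare) (x : Fin 4 → ℝ) : g⁻¹ (g x) = x := by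
  rw [← mul_apply, inv_mul_cancel]; rfl

theorem apply_inv_self (g : Poincare) (x : Fin 4 → ℝ) : g (g⁻¹ x) = x := by
  rw [← mul_apply, mul_inv_cancel]; rfl

theorem injective (g : Poincare) : Function.Injective g := g.1.injective

/-- Invertibility is automatic: a linear map preserving a nondegenerate form is injective, and the
dimension is finite. -/
theorem exists_eq_add (L : (Fin 4 → ℝ) →ₗ[ℝ] (Fin 4 → ℝ)) (r : Fin 4 → ℝ)
    (hL : ∀ x, minkowski (L x) = minkowski x) : ∃ g : Poincare, ∀ x, g x = L x + r := by
  have hinj : Function.Injective L := by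
    rw [injective_iff_map_eq_zero]
    intro x hx
    have h₁ := hL x
    -- Adding to `x` its spatial mirror image leaves only the time component, so a null vector
    -- killed by `L` must have `x 0 = 0`.
    have h₂ := hL (x + ![x 0, -x 1, -x 2, -x 3])
    have h₃ := hL ![x 0, -x 1, -x 2, -x 3]
    rw [map_add, hx, zero_add, h₃] at h₂
    rw [hx] at h₁
    simp [minkowski] at h₁ h₂
    have h0 : x 0 ^ 2 = 0 := by linarith
    have h₁' := sq_nonneg (x 1)
    have h₂' := sq_nonneg (x 2)
    have h₃' := sq_nonneg (x 3)
    have hx1 : x 1 ^ 2 = 0 := by linarith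
    have hx2 : x 2 ^ 2 = 0 := by linarith
    have hx3 : x 3 ^ 2 = 0 := by linarith
    rw [pow_eq_zero_iff two_ne_zero] at h0 hx1 hx2 hx3
    funext i
    fin_cases i <;> assumption
  refine ⟨⟨(LinearEquiv.ofInjectiveEndo L hinj).toAffineEquiv.trans
    (AffineEquiv.constVAdd ℝ _ r), fun x y => ?_⟩, fun x => ?_⟩
  · simp only [AffineEquiv.trans_apply, AffineEquiv.constVAdd_apply, vadd_eq_add,
      LinearEquiv.coe_toAffineEquiv, LinearEquiv.coe_ofInjectiveEndo, add_sub_add_left_eq_sub,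
      ← map_sub, hL]
  · simp [add_comm]

/-- The reflection in the hyperplane orthogonal to `u`. -/
noncomputable def reflection (u : Fin 4 → ℝ) : (Fin 4 → ℝ) →ₗ[ℝ] (Fin 4 → ℝ) where
  toFun x := x - (2 * (x 0 * u 0 - x 1 * u 1 - x 2 * u 2 - x 3 * u 3) / minkowski u) • u
  map_add' x y := by ext i; simp; ring
  map_smul' a x := by ext i; simp; ring

theorem minkowski_reflection {u : Fin 4 → ℝ} (hu : minkowski u ≠ 0) (x : Fin 4 → ℝ) :
    minkowski (reflection u x) = minkowski x := by
  obtain ⟨a, ha⟩ : ∃ a, a =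
    2 * (x 0 * u 0 - x 1 * u 1 - x 2 * u 2 - x 3 * u 3) / minkowski u := ⟨_, rfl⟩
  have h : a * minkowski u = 2 * (x 0 * u 0 - x 1 * u 1 - x 2 * u 2 - x 3 * u 3) := by
    rw [ha, div_mul_cancel₀ _ hu]
  simp only [reflection, LinearMap.coe_mk, AddHom.coe_mk, ← ha]
  simp only [minkowski, Pi.sub_apply, Pi.smul_apply, smul_eq_mul] at h ⊢
  linear_combination a * h

/-- As `x` and `y` have equal norm, twice the product of `x` with `x - y` is the norm of `x - y`, so
the coefficient in the reflection is 1. -/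
theorem reflection_sub {x y : Fin 4 → ℝ} (h : minkowski x = minkowski y)
    (hxy : minkowski (x - y) ≠ 0) : reflection (x - y) x = y := by
  have : 2 * (x 0 * (x - y) 0 - x 1 * (x - y) 1 - x 2 * (x - y) 2 - x 3 * (x - y) 3) =
      minkowski (x - y) := by
    simp only [minkowski, Pi.sub_apply] at h ⊢
    linear_combination h
  simp only [reflection, LinearMap.coe_mk, AddHom.coe_mk]
  rw [this, div_self hxy, one_smul, sub_sub_cancel]

/-- A translation takes `x` to the origin; the reflection along `y - x - b` then takes `y - x` to
`b`, provided this vector is not null. If it vanishes, the translation is enough. -/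
theorem exists_map_pair (x y b : Fin 4 → ℝ) (h : minkowski (y - x) = minkowski b)
    (hb : y - x = b ∨ minkowski (y - x - b) ≠ 0) : ∃ g : Poincare, g x = 0 ∧ g y = b := by
  rcases hb with hb | hb
  · obtain ⟨g, hg⟩ := exists_eq_add LinearMap.id (-x) fun _ => rfl
    exact ⟨g, by simp [hg], by simp [hg, ← hb, sub_eq_add_neg]⟩
  · obtain ⟨g, hg⟩ := exists_eq_add (reflection (y - x - b)) (-reflection (y - x - b) x)
      (minkowski_reflection hb)
    exact ⟨g, by simp [hg], by rw [hg, ← sub_eq_add_neg, ← map_sub, reflection_sub h hb]⟩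

end Poincare

/-! ### A model of special relativity -/

/-- The worldlines of the standard observer and of the standard light signal. -/
def stdLine (s : Bool) : Set (Fin 4 → ℝ) := {x | x 1 = (if s then x 0 else 0) ∧ x 2 = 0 ∧ x 3 = 0}

theorem mem_stdLine_false {x : Fin 4 → ℝ} : x ∈ stdLine false ↔ x 1 = 0 ∧ x 2 = 0 ∧ x 3 = 0 := by
  simp [stdLine]

theorem mem_stdLine_true {x : Fin 4 → ℝ} : x ∈ stdLine true ↔ x 1 = x 0 ∧ x 2 = 0 ∧ x 3 = 0 := by
  simp [stdLine]

theorem zero_mem_stdLine (s : Bool) : 0 ∈ stdLine s := by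
  simp [stdLine]

namespace Poincare

theorem exists_mem_axis {x y : Fin 4 → ℝ} (h : 0 < minkowski (x - y)) :
    ∃ g : Poincare, g x ∈ stdLine false ∧ g y ∈ stdLine false := by
  have hsymm : minkowski (y - x) = minkowski (x - y) := by
    simp only [minkowski, Pi.sub_apply]; ring
  -- The target is `(t, 0, 0, 0)`. With the sign of `t` opposite to that of `y 0 - x 0`, the norm of
  -- the reflecting vector is `2 (t² - (y 0 - x 0) t) > 0`.
  have key : ∀ t : ℝ, t ^ 2 = minkowski (x - y) → (y 0 - x 0) * t ≤ 0 →
      ∃ g : Poincare, g x ∈ stdLine false ∧ g y ∈ stdLine false := by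
    intro t ht hneg
    obtain ⟨g, hx, hy⟩ := exists_map_pair x y ![t, 0, 0, 0]
      (by rw [hsymm, ← ht]; simp [minkowski]) (Or.inr (by
        rw [← hsymm] at h ht
        simp only [minkowski, Pi.sub_apply] at h ht ⊢
        simp
        nlinarith))
    exact ⟨g, hx ▸ zero_mem_stdLine _, by rw [hy, mem_stdLine_false]; simp⟩
  have hsq := Real.sq_sqrt h.le
  rcases le_total (y 0 - x 0) 0 with h0 | h0
  · exact key _ hsq (mul_nonpos_of_nonpos_of_nonneg h0 (Real.sqrt_nonneg _))
  · refine key (-√(minkowski (x - y))) (by rw [neg_sq, hsq]) ?_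
    exact mul_nonpos_of_nonneg_of_nonpos h0 (neg_nonpos.2 (Real.sqrt_nonneg _))

/-- The target has the same time component as `y - x`, so their difference is purely spatial, and a
purely spatial null vector is zero. -/
theorem exists_mem_light {x y : Fin 4 → ℝ} (h : minkowski (x - y) = 0) :
    ∃ g : Poincare, g x ∈ stdLine true ∧ g y ∈ stdLine true := by
  obtain ⟨g, hx, hy⟩ := exists_map_pair x y ![y 0 - x 0, y 0 - x 0, 0, 0]
    (by simp [minkowski] at h ⊢; linarith) (by
      rw [or_iff_not_imp_right, not_not]
      intro h'
      simp [minkowski] at h h'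
      have h₁ : (y 1 - x 1 - (y 0 - x 0)) ^ 2 = 0 := by
        nlinarith [sq_nonneg (y 1 - x 1 - (y 0 - x 0)), sq_nonneg (y 2 - x 2), sq_nonneg (y 3 - x 3)]
      have h₂ : (y 2 - x 2) ^ 2 = 0 := by
        nlinarith [sq_nonneg (y 1 - x 1 - (y 0 - x 0)), sq_nonneg (y 2 - x 2), sq_nonneg (y 3 - x 3)]
      have h₃ : (y 3 - x 3) ^ 2 = 0 := by
        nlinarith [sq_nonneg (y 1 - x 1 - (y 0 - x 0)), sq_nonneg (y 2 - x 2), sq_nonneg (y 3 - x 3)]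
      rw [pow_eq_zero_iff two_ne_zero] at h₁ h₂ h₃
      funext i
      fin_cases i
      exacts [rfl, sub_eq_zero.1 h₁, h₂, h₃])
  exact ⟨g, hx ▸ zero_mem_stdLine _, by rw [hy, mem_stdLine_true]; simp⟩

end Poincare

/-- The structure over `ℝ` in which inertial observers and light signals are labelled by the
elements of the Poincaré group: the observer `k` assigns the coordinates `k x` to the event `x`,
and the worldlines of the observer `h` and of the light signal `h` are the images of the standard
ones under `h⁻¹`. -/
def minkowskiStruc : Struc (Poincare × Bool) ℝ where
  add := (· + ·)
  mul := (· * ·)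
  le := (· ≤ ·)
  IOb k := k.2 = false
  Ph p := p.2 = true
  W k b x := k.2 = false ∧ (b.1 * k.1⁻¹) x ∈ stdLine b.2

/-! ### The axioms of special relativity in the Minkowski model, and its automorphisms -/

namespace minkowskiStruc

instance : minkowskiStruc.IsOverField := ⟨fun _ _ => rfl, fun _ _ => rfl, fun _ _ => Iff.rfl⟩

theorem hasSqrt_real : HasSqrt ℝ := fun a ha => ⟨√a, Real.sqrt_nonneg a, Real.sq_sqrt ha⟩

theorem W_iff (k : Poincare) (b : Poincare × Bool) (x : Fin 4 → ℝ) :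
    minkowskiStruc.W (k, false) b x ↔ b.1 (k⁻¹ x) ∈ stdLine b.2 :=
  and_iff_right rfl

/-- Events are separated by the bodies present: the translation `g` taking the event to the origin
labels an observer and a light signal that both pass through it, and the two standard lines meet
only in the origin. -/
theorem sameEv_iff (k h : Poincare) (x y : Fin 4 → ℝ) :
    minkowskiStruc.SameEv (k, false) (h, false) x y ↔ y = (h * k⁻¹) x := by
  simp only [SameEv, W_iff]
  constructor
  · intro H
    obtain ⟨g, hg⟩ := Poincare.exists_eq_add LinearMap.id (-(k⁻¹ x)) fun _ => rfl
    have key : ∀ s, g (h⁻¹ y) ∈ stdLine s := fun s => by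
      refine (H (g, s)).1 ?_
      have : g (k⁻¹ x) = 0 := by simp [hg]
      rw [this]; exact zero_mem_stdLine s
    obtain ⟨h₁, h₂, h₃⟩ := mem_stdLine_false.1 (key false)
    obtain ⟨h₀, -, -⟩ := mem_stdLine_true.1 (key true)
    have h0 : g (h⁻¹ y) = 0 := by
      funext i
      fin_cases i
      exacts [h₀.symm.trans h₁, h₁, h₂, h₃]
    rw [hg, LinearMap.id_apply, ← sub_eq_add_neg, sub_eq_zero] at h0
    rw [Poincare.mul_apply, ← h0, Poincare.apply_inv_self]
  · rintro rfl b
    rw [Poincare.mul_apply, Poincare.inv_apply_self]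

theorem lightSpeedFor_one (k : Poincare × Bool) (hk : minkowskiStruc.IOb k) :
    minkowskiStruc.LightSpeedFor k 1 := by
  obtain ⟨k, _⟩ := k
  obtain rfl : _ = false := hk
  intro x y
  have h : spaceSq x y = (1 * (x 0 - y 0)) ^ 2 ↔ minkowski (k⁻¹ x - k⁻¹ y) = 0 := by
    rw [Poincare.minkowski_apply_sub, minkowski_sub, sub_eq_zero, one_mul, eq_comm]
  rw [h]
  simp only [W_iff]
  constructor
  · rintro ⟨⟨p, _⟩, rfl, hx, hy⟩
    dsimp only at hx hy
    rw [← Poincare.minkowski_apply_sub p]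
    obtain ⟨x₁, x₂, x₃⟩ := mem_stdLine_true.1 hx
    obtain ⟨y₁, y₂, y₃⟩ := mem_stdLine_true.1 hy
    simp only [minkowski, Pi.sub_apply]
    rw [x₁, x₂, x₃, y₁, y₂, y₃]
    ring
  · intro h0
    obtain ⟨p, hp⟩ := Poincare.exists_mem_light h0
    exact ⟨(p, true), rfl, hp⟩

theorem sat_AxEField : minkowskiStruc.Sat AxEField Fin.elim0 Fin.elim0 := by
  rw [Struc.sat_AxEField]
  simp only [IsOverField.add_eq, IsOverField.mul_eq, IsOverField.le_iff, add_eq_left]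
  refine ⟨add_assoc, add_comm, ⟨0, fun _ => rfl⟩, fun a => ⟨-a, fun _ => add_neg_cancel a⟩, mul_assoc, mul_comm,
    ⟨1, mul_one, fun h => one_ne_zero (h 0)⟩, fun a ha => ⟨a⁻¹, fun c => ?_⟩, mul_add, le_refl,
    fun a b h => le_antisymm h.1 h.2, fun a b c h => h.1.trans h.2, le_total,
    fun a b c h => by linarith, ?_, ?_⟩
  · rw [mul_inv_cancel₀ fun h => ha fun _ => h, mul_one]
  · simpa using fun a b => mul_nonneg
  · rintro a ⟨z, hz, hle, -⟩
    exact ⟨√a, Real.mul_self_sqrt (by rwa [hz 0] at hle)⟩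

theorem sat_AxLine : minkowskiStruc.Sat AxLine Fin.elim0 Fin.elim0 := by
  rw [Struc.sat_AxLine]
  rintro ⟨k, _⟩ ⟨h, _⟩ rfl rfl x y z ⟨-, hx⟩ ⟨-, hy⟩ ⟨-, hz⟩
  generalize h * k⁻¹ = f at hx hy hz
  obtain ⟨x₁, x₂, x₃⟩ := mem_stdLine_false.1 hx
  obtain ⟨y₁, y₂, y₃⟩ := mem_stdLine_false.1 hy
  obtain ⟨z₁, z₂, z₃⟩ := mem_stdLine_false.1 hz
  by_cases h0 : f y 0 = f x 0
  · have hxy : f y = f x := by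
      funext i
      fin_cases i
      exacts [h0, y₁.trans x₁.symm, y₂.trans x₂.symm, y₃.trans x₃.symm]
    rw [Poincare.injective f hxy]
    -- When `y = x`, the first alternative would force `z = x`; the second holds with `a = -1`.
    exact ⟨-1, .inr fun i => by ring⟩
  -- The images under `f` lie on the time axis, where the ratio can be read off; affine maps
  -- preserve it.
  · have hz : z = AffineMap.lineMap x y ((f z 0 - f x 0) / (f y 0 - f x 0)) := by
      apply Poincare.injective f
      refine Eq.trans ?_ (f.1.apply_lineMap x y _).symm
      rw [AffineMap.lineMap_apply_module']
      funext i
      fin_cases i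
      · simp [div_mul_cancel₀ _ (sub_ne_zero.2 h0)]
      · simp [x₁, y₁, z₁]
      · simp [x₂, y₂, z₂]
      · simp [x₃, y₃, z₃]
    refine ⟨(f z 0 - f x 0) / (f y 0 - f x 0), .inl fun i => ?_⟩
    rw [congrFun hz i, AffineMap.lineMap_apply_module']
    simp only [Pi.add_apply, Pi.smul_apply, Pi.sub_apply, smul_eq_mul]
    ring

theorem sat_AxTriv : minkowskiStruc.Sat AxTriv Fin.elim0 Fin.elim0 := by
  refine minkowskiStruc.sat_AxTriv_of hasSqrt_real ?_
  rintro A r hT ⟨k, _⟩ rfl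
  have haff : ∀ x, affineMap A r x = Matrix.mulVecLin (Matrix.of A) x + r := by
    intro x
    funext i
    simp [affineMap, Matrix.mulVec, dotProduct, Fin.sum_univ_four]
  -- A trivial transformation preserves time differences and spatial distances, hence the Minkowski
  -- form.
  obtain ⟨g, hg⟩ := Poincare.exists_eq_add (Matrix.mulVecLin (Matrix.of A)) r fun x => by
    have h₁ : Matrix.mulVecLin (Matrix.of A) x = affineMap A r x - affineMap A r 0 := by
      rw [haff, haff, map_zero]; abel
    rw [h₁, minkowski_sub, ← (hT x 0).2, (hT x 0).1, (hT 0 0).1, add_sub_add_right_eq_sub,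
      ← minkowski_sub, sub_zero]
  refine ⟨(g * k, false), rfl, fun x x' => ?_⟩
  rw [sameEv_iff, mul_inv_cancel_right, hg, haff]

theorem sat_AxThExp : minkowskiStruc.Sat AxThExp Fin.elim0 Fin.elim0 := by
  refine minkowskiStruc.sat_AxThExp_of ⟨(1, false), rfl⟩ ?_
  rintro c - hc ⟨k, _⟩ rfl x y hxy
  -- The speed `c` supplied by the axiom is compared with the speed 1 on a single lightlike pair.
  have hc1 : c ^ 2 = 1 := by
    have h := (lightSpeedFor_one (1, false) rfl ![1, 1, 0, 0] 0).symm.trans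
      (hc (1, false) rfl ![1, 1, 0, 0] 0)
    simpa [spaceSq, eq_comm] using h
  rw [mul_pow, hc1, one_mul, ← sub_pos, ← minkowski_sub, ← Poincare.minkowski_apply_sub k⁻¹] at hxy
  obtain ⟨h, hx, hy⟩ := Poincare.exists_mem_axis hxy
  exact ⟨(h, false), rfl, (W_iff _ _ _).2 hx, (W_iff _ _ _).2 hy⟩

theorem models_specRelFull : minkowskiStruc.Models SpecRelFull := by
  rintro σ ((rfl | rfl | rfl | rfl | rfl | rfl | rfl) | (rfl | rfl))
  · exact sat_AxEField
  · refine minkowskiStruc.sat_AxEv.2 ?_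
    rintro ⟨k, _⟩ ⟨h, _⟩ rfl rfl x
    exact ⟨_, (sameEv_iff _ _ _ _).2 rfl⟩
  · refine minkowskiStruc.sat_AxSelf.2 ?_
    rintro ⟨k, _⟩ rfl x
    rw [W_iff, Poincare.apply_inv_self, mem_stdLine_false]
  · refine (minkowskiStruc.sat_AxSymD hasSqrt_real).2 ?_
    rintro ⟨k, _⟩ ⟨h, _⟩ rfl rfl x y x' y' h₁ h₂ hx hy
    rw [sameEv_iff] at hx hy
    have := Poincare.minkowski_apply_sub (h * k⁻¹) x y
    rw [← hx, ← hy, minkowski_sub, minkowski_sub, h₁, h₂] at this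
    linarith
  · exact sat_AxLine
  · exact sat_AxTriv
  · exact minkowskiStruc.sat_AxNoAcc.2 fun k ⟨_, _, hk⟩ => hk.1
  · exact minkowskiStruc.sat_AxPhc.2 ⟨1, one_pos, lightSpeedFor_one⟩
  · exact sat_AxThExp

/-- Multiplication by an element of the Poincaré group on the right is an automorphism. -/
theorem isAut_mulRight (g : Poincare) :
    minkowskiStruc.IsAut ((Equiv.mulRight g).prodCongr (Equiv.refl Bool)) where
  IOb _ := Iff.rfl
  Ph _ := Iff.rfl
  W k b x := by
    -- The relation `W` depends on the two labels only through their quotient.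
    have h : (b.1 * g) * (k.1 * g)⁻¹ = b.1 * k.1⁻¹ := by group
    change _ ∧ ((b.1 * g) * (k.1 * g)⁻¹) x ∈ _ ↔ _
    rw [h]; rfl

theorem exists_isAut (b b' : Poincare × Bool) (h : b.2 = b'.2) :
    ∃ π, minkowskiStruc.IsAut π ∧ π b = b' :=
  ⟨_, isAut_mulRight (b.1⁻¹ * b'.1), Prod.ext (by simp) h⟩

end minkowskiStruc

end Kinematics

theorem mainTheorem8 :
    ¬ Kinematics.SpecRelFull.DefinitionallyEquivalent Kinematics.ClassicalKinFull := by
  -- `Tr` is the interpretation of classical kinematics in special relativity.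
  rintro ⟨_, -, Tr, hTr, -, -⟩
  have hM := Kinematics.minkowskiStruc.models_specRelFull
  -- The flag of a body, observer or signal, serves as the two-valued orbit label.
  refine (hM.struc hTr).false_of_two_orbits Prod.snd fun b b' h => ?_
  obtain ⟨π, hπ, hb⟩ := Kinematics.minkowskiStruc.exists_isAut b b' h
  exact ⟨π, hπ.struc _, hb⟩
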